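/- Let $E$ be a real separable Banach space (for instance $\mathbb{R}^d$). Let $ID_{\log}$ be the set of infinitely divisible Borel probability measures $\nu$ on $E$ with $\int_E \log(1+\|x\|)\,\nu(dx)<\infty$. For an infinitely divisible law $\mu$, let $Y_\mu=(Y_\mu(t))_{t\ge 0}$ denote any $E$-valued Lévy process (stationary independent increments, $Y_\mu(0)=0$, right-continuous paths with left limits) such that $Y_\mu(1)$ has law $\mu$. Random integrals $\int_a^b f(s)\,dX(s)$ are pathwise Riemann–Stieltjes integrals, and $\int_0^\infty f\,dX:=\lim_{b\to\infty}\int_0^b f\,dX$. For $\beta>0$ put $$\mathcal{J}^\beta(\nu):=\mathcal{L}\Big(\int_0^1 t^{1/\beta}\,dY_\nu(t)\Big),\qquad \mathcal{I}(\mu):=\mathcal{L}\Big(\int_0^\infty e^{-s}\,dY_\mu(s)\Big)\quad(\mu\in ID_{\log}),$$ where $\mathcal{L}(X)$ denotes the law of $X$, and let $\sigma_\beta(s):=s+\frac1\beta e^{-\beta s}-\frac1\beta$ for $s\ge 0$. Let $\nu\in ID_{\log}$ and $\beta>0$, and let $Y_\nu$ be a Lévy process such that $Y_\nu(1)$ has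 law $\nu$. Then the integral defining $\mathcal{J}^\beta(\nu)$ exists almost surely, its law does not depend on the choice of the Lévy process, and $\mathcal{J}^\beta(\nu)\in ID_{\log}$. The improper integrals $\int_0^\infty e^{-s}\,dY_{\mathcal{J}^\beta(\nu)}(s)$ (for every Lévy process $Y_{\mathcal{J}^\beta(\nu)}$ whose law at time $1$ is $\mathcal{J}^\beta(\nu)$) and $\int_0^\infty e^{-s}\,dY_\nu(\sigma_\beta(s))$ converge almost surely, and $$\mathcal{I}(\mathcal{J}^\beta(\nu))=\mathcal{L}\Big(\int_0^\infty e^{-s}\,dY_\nu(\sigma_\beta(s))\Big).$$ -/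

import Mathlib

open MeasureTheory ProbabilityTheory Filter Topology
open scoped NNReal

namespace RandomIntegral

/-- The `n`-fold convolution power of a measure; the zeroth power is the unit mass at `0`. -/
noncomputable def convPow {E : Type*} [AddMonoid E] [MeasurableSpace E] (κ : Measure E) :
    ℕ → Measure E
  | 0 => Measure.dirac 0
  | n + 1 => (convPow κ n).conv κ

/-- Infinitely divisible probability measures (the class `ID`): for every `n ≥ 1` there is a
probability measure whose `n`-fold convolution power is the given one. -/
def IsID {E : Type*} [AddMonoid E] [MeasurableSpace E] (ν : Measure E) : Prop :=
  IsProbabilityMeasure ν ∧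
    ∀ n : ℕ, 0 < n → ∃ κ : Measure E, IsProbabilityMeasure κ ∧ convPow κ n = ν

/-- The class `ID_log`: infinitely divisible probability measures that integrate the function
`x ↦ log (1 + ‖x‖)`. -/
def IsIDLog {E : Type*} [NormedAddCommGroup E] [MeasurableSpace E] (ν : Measure E) : Prop :=
  IsID ν ∧ Integrable (fun x : E => Real.log (1 + ‖x‖)) ν

/-- Right-continuous functions on `[0, ∞)` with left limits. -/
def IsCadlag {E : Type*} [TopologicalSpace E] (g : ℝ≥0 → E) : Prop :=
  ∀ t : ℝ≥0, ContinuousWithinAt g (Set.Ici t) t ∧ ∃ l : E, Tendsto g (𝓝[<] t) (𝓝 l)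

/-- Lévy processes: stationary independent increments, started at zero, càdlàg paths. -/
structure IsLevyProcess {E : Type*} [NormedAddCommGroup E] [MeasurableSpace E]
    {Ω : Type*} [MeasurableSpace Ω] (Y : ℝ≥0 → Ω → E) (P : Measure Ω) : Prop where
  measurable : ∀ t, Measurable (Y t)
  start_zero : ∀ᵐ ω ∂P, Y 0 ω = 0
  indep_increments : HasIndepIncrements Y P
  stationary_increments : ∀ s t h : ℝ≥0,
    IdentDistrib (fun ω => Y (s + h) ω - Y s ω) (fun ω => Y (t + h) ω - Y t ω) P P
  cadlag : ∀ᵐ ω ∂P, IsCadlag (fun t => Y t ω)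

/-- `HasRSIntegral f g a b x`: the Riemann–Stieltjes integral `∫_a^b f dg` of a scalar function
`f` against a vector-valued function `g` exists and equals `x`, that is, the sums
`∑ f(ξ_i) (g(t_{i+1}) - g(t_i))` over tagged partitions `a = t_0 ≤ ξ_0 ≤ t_1 ≤ ⋯ ≤ t_n = b`
converge to `x` as the mesh tends to zero. -/
def HasRSIntegral {E : Type*} [NormedAddCommGroup E] [NormedSpace ℝ E]
    (f : ℝ≥0 → ℝ) (g : ℝ≥0 → E) (a b : ℝ≥0) (x : E) : Prop :=
  ∀ ε : ℝ, 0 < ε → ∃ δ : ℝ≥0, 0 < δ ∧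
    ∀ (n : ℕ) (t ξ : ℕ → ℝ≥0), t 0 = a → t n = b →
      (∀ i < n, t i ≤ ξ i ∧ ξ i ≤ t (i + 1) ∧ t (i + 1) ≤ t i + δ) →
      ‖∑ i ∈ Finset.range n, f (ξ i) • (g (t (i + 1)) - g (t i)) - x‖ < ε

/-- The improper integral `∫_0^∞ f dg = lim_{b → ∞} ∫_0^b f dg` converges to `x`. -/
def HasImproperRSIntegral {E : Type*} [NormedAddCommGroup E] [NormedSpace ℝ E]
    (f : ℝ≥0 → ℝ) (g : ℝ≥0 → E) (x : E) : Prop :=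
  ∃ F : ℝ≥0 → E, (∀ b, HasRSIntegral f g 0 b (F b)) ∧ Tendsto F atTop (𝓝 x)

/-- The random integral `∫_a^b f(s) dX(s)` exists almost surely, and `ρ` is its law. -/
def IntegralHasLaw {E : Type*} [NormedAddCommGroup E] [NormedSpace ℝ E] [MeasurableSpace E]
    {Ω : Type*} [MeasurableSpace Ω] (f : ℝ≥0 → ℝ) (X : ℝ≥0 → Ω → E) (a b : ℝ≥0)
    (P : Measure Ω) (ρ : Measure E) : Prop :=
  ∃ I : Ω → E, (∀ᵐ ω ∂P, HasRSIntegral f (fun s => X s ω) a b (I ω)) ∧ HasLaw I ρ P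

/-- The improper random integral `∫_0^∞ f(s) dX(s)` converges almost surely, and `ρ` is its law. -/
def ImproperIntegralHasLaw {E : Type*} [NormedAddCommGroup E] [NormedSpace ℝ E]
    [MeasurableSpace E] {Ω : Type*} [MeasurableSpace Ω] (f : ℝ≥0 → ℝ) (X : ℝ≥0 → Ω → E)
    (P : Measure Ω) (ρ : Measure E) : Prop :=
  ∃ I : Ω → E, (∀ᵐ ω ∂P, HasImproperRSIntegral f (fun s => X s ω) (I ω)) ∧ HasLaw I ρ P

/-- The inner clock `σ_β(s) = s + (1/β) e^{-β s} - 1/β`, as a map of `[0, ∞)` to itself. -/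
noncomputable def clock (β : ℝ) (s : ℝ≥0) : ℝ≥0 :=
  Real.toNNReal ((s : ℝ) + 1 / β * Real.exp (-β * s) - 1 / β)

/-- The truncation in `clock` is never active. -/
theorem coe_clock {β : ℝ} (hβ : 0 < β) (s : ℝ≥0) :
    (clock β s : ℝ) = (s : ℝ) + 1 / β * Real.exp (-β * s) - 1 / β := by
  apply Real.coe_toNNReal
  have h := Real.add_one_le_exp (-β * s)
  have h2 : 1 / β * (-β * s + 1) ≤ 1 / β * Real.exp (-β * s) :=
    mul_le_mul_of_nonneg_left h (by positivity)
  have h3 : 1 / β * (-β * s + 1) = -(s : ℝ) + 1 / β := by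
    field_simp
  linarith

end RandomIntegral

universe u v w

open RandomIntegral

/-! A law is identified by its characteristic functional. A Lévy process has a continuous exponent ψ
on the dual space with ψ(0) = 0 and E exp(i L(Y(t))) = exp(t ψ(L)); continuity and the value at 0
make ψ depend only on the law of Y(1) (`exponent_unique`). Passing to the limit in Riemann–Stieltjes
sums, the integral of f against Y(σ(s)) over [0,b] has exponent L ↦ ∫_0^b σ'(s) ψ(f(s)L) ds
(`IsLevyProcess.charFunDual_integral`).

So 𝒥^β(ν) has exponent ψ_β(L) = ∫_0^1 ψ(t^{1/β}L) dt. Substitution gives ψ_β(e^{-s}L) = e^{βs}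
∫_0^{e^{-βs}} ψ(x^{1/β}L) dx. Integrating over [0,n] by parts produces ∫_0^n (1 - e^{-βs})
ψ(e^{-s}L) ds plus a boundary term, a bounded factor times ψ_β(e^{-n}L), which vanishes as n → ∞.
Since 1 - e^{-βs} is the derivative of σ_β, the two improper integrals have the same characteristic
functional.

Existence is pathwise. Càdlàg paths are uniform limits of step functions on bounded intervals, and
summation by parts bounds the sums for monotone f by the supremum of the path
(`IsCadlag.exists_hasRSIntegral`). For the improper integrals, Ottaviani's inequality and
Borel–Cantelli turn the logarithmic moment into path growth at most K e^{t/2}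
(`IsLevyProcess.ae_exists_norm_le`), which e^{-s} beats. The same maximal inequality carries the
logarithmic moment over to 𝒥^β(ν), and slowing the clock by a factor n gives convolution roots
(`IsLevyProcess.isIDLog_power_integral`). -/

namespace RandomIntegral

/-! ### Riemann–Stieltjes integration along càdlàg paths -/

section Path

variable {E : Type*} [NormedAddCommGroup E] [NormedSpace ℝ E]

/-- Number of intervals, division points and tags of a tagged partition. -/
abbrev TaggedPartition := ℕ × (ℕ → ℝ≥0) × (ℕ → ℝ≥0)

/-- Tagged partitions of `[a, b]` of mesh at most `δ`. -/
def finePartitions (a b δ : ℝ≥0) : Set TaggedPartition :=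
  {p | p.2.1 0 = a ∧ p.2.1 p.1 = b ∧
    ∀ i < p.1, p.2.1 i ≤ p.2.2 i ∧ p.2.2 i ≤ p.2.1 (i + 1) ∧ p.2.1 (i + 1) ≤ p.2.1 i + δ}

/-- The filter of tagged partitions of `[a, b]` whose mesh tends to zero. -/
def meshFilter (a b : ℝ≥0) : Filter TaggedPartition :=
  ⨅ δ : {δ : ℝ≥0 // 0 < δ}, 𝓟 (finePartitions a b δ)

/-- The Riemann–Stieltjes sum of a tagged partition. -/
def rsSum (f : ℝ≥0 → ℝ) (g : ℝ≥0 → E) (p : TaggedPartition) : E :=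
  ∑ i ∈ Finset.range p.1, f (p.2.2 i) • (g (p.2.1 (i + 1)) - g (p.2.1 i))

lemma finePartitions_mono {a b δ δ' : ℝ≥0} (h : δ ≤ δ') :
    finePartitions a b δ ⊆ finePartitions a b δ' := fun _ hp =>
  ⟨hp.1, hp.2.1, fun i hi => ⟨(hp.2.2 i hi).1, (hp.2.2 i hi).2.1,
    (hp.2.2 i hi).2.2.trans (by gcongr)⟩⟩

lemma meshFilter_hasBasis (a b : ℝ≥0) :
    (meshFilter a b).HasBasis (fun _ : {δ : ℝ≥0 // 0 < δ} => True)
      (fun δ => finePartitions a b δ) := by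
  have : Nonempty {δ : ℝ≥0 // 0 < δ} := ⟨⟨1, one_pos⟩⟩
  refine hasBasis_iInf_principal ?_
  intro x y
  exact ⟨⟨min x.1 y.1, lt_min x.2 y.2⟩, finePartitions_mono (min_le_left _ _),
    finePartitions_mono (min_le_right _ _)⟩

/-- As a limit along a filter, the integral inherits uniqueness, additivity in the integrator and
the Cauchy criterion. -/
lemma hasRSIntegral_iff_tendsto {f : ℝ≥0 → ℝ} {g : ℝ≥0 → E} {a b : ℝ≥0} {x : E} :
    HasRSIntegral f g a b x ↔ Tendsto (rsSum f g) (meshFilter a b) (𝓝 x) := by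
  rw [(meshFilter_hasBasis a b).tendsto_iff Metric.nhds_basis_ball]
  simp only [true_and, Subtype.exists, Metric.mem_ball, dist_eq_norm]
  refine forall_congr' fun ε => forall_congr' fun hε => exists_congr fun δ => ?_
  rw [exists_prop]
  refine and_congr_right fun hδ => ?_
  constructor
  · rintro h ⟨n, t, ξ⟩ ⟨h1, h2, h3⟩
    exact h n t ξ h1 h2 h3
  · intro h n t ξ h1 h2 h3
    exact h (n, t, ξ) ⟨h1, h2, h3⟩

/-- The partition of `[a, b]` into `N + 1` equal parts, tagged by left end points. -/
noncomputable def uniformPartition (a b : ℝ≥0) (N : ℕ) : TaggedPartition :=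
  (N + 1, fun i => a + i * ((b - a) / (N + 1)), fun i => a + i * ((b - a) / (N + 1)))

lemma tendsto_uniformPartition {a b : ℝ≥0} (hab : a ≤ b) :
    Tendsto (uniformPartition a b) atTop (meshFilter a b) := by
  rw [(meshFilter_hasBasis a b).tendsto_right_iff]
  rintro ⟨δ, hδ⟩ -
  have h : Tendsto (fun N : ℕ => (b - a) / ((N : ℝ≥0) + 1)) atTop (𝓝 0) := by
    rw [← NNReal.tendsto_coe]
    have := (tendsto_const_div_atTop_nhds_zero_nat ((b - a : ℝ≥0) : ℝ)).comp
      (tendsto_add_atTop_nat 1)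
    simpa only [Function.comp_def, Nat.cast_add, Nat.cast_one, NNReal.coe_div, NNReal.coe_add,
      NNReal.coe_natCast, NNReal.coe_one, NNReal.coe_zero] using this
  filter_upwards [h.eventually (ge_mem_nhds hδ)] with N hN
  refine ⟨by simp [uniformPartition], ?_, fun i _ => ⟨le_rfl, ?_, ?_⟩⟩
  · simp only [uniformPartition]
    push_cast
    rw [mul_div_cancel₀ _ (by positivity), add_tsub_cancel_of_le hab]
  · simp only [uniformPartition]
    push_cast
    gcongr
    simp
  · simp only [uniformPartition]
    push_cast
    rw [add_mul, one_mul, ← add_assoc]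
    gcongr

lemma meshFilter_neBot {a b : ℝ≥0} (hab : a ≤ b) : (meshFilter a b).NeBot :=
  (tendsto_uniformPartition hab).neBot

lemma finePartitions_le {a b δ : ℝ≥0} {p : TaggedPartition} (hp : p ∈ finePartitions a b δ)
    {i : ℕ} (hi : i ≤ p.1) : a ≤ p.2.1 i ∧ p.2.1 i ≤ b := by
  obtain ⟨h0, h1, h2⟩ := hp
  constructor
  · induction i with
    | zero => exact h0.ge
    | succ i ih =>
      exact (ih (by omega)).trans ((h2 i (by omega)).1.trans (h2 i (by omega)).2.1)
  · induction hi using Nat.decreasingInduction with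
    | self => exact h1.le
    | of_succ k hk ih => exact ((h2 k hk).1.trans (h2 k hk).2.1).trans ih

/-- Summation by parts for monotone integrands. -/
lemma norm_rsSum_le_of_monotone {f : ℝ≥0 → ℝ} (hf : Monotone f) {g : ℝ≥0 → E} {a b δ : ℝ≥0}
    {p : TaggedPartition} (hp : p ∈ finePartitions a b δ) {M : ℝ}
    (hM : ∀ t, a ≤ t → t ≤ b → ‖g t‖ ≤ M) :
    ‖rsSum f g p‖ ≤ 2 * (|f a| + |f b|) * M := by
  have hg : ∀ i ≤ p.1, ‖g (p.2.1 i)‖ ≤ M := fun i hi =>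
    hM _ (finePartitions_le hp hi).1 (finePartitions_le hp hi).2
  have hM0 : 0 ≤ M := (norm_nonneg _).trans (hg 0 (Nat.zero_le _))
  obtain ⟨h0, h1, h2⟩ := hp
  set t := p.2.1
  set ξ := p.2.2
  -- Abel summation as an induction: after subtracting the boundary term, the error grows only with
  -- the variation f(t_k) - f(a).
  have key : ∀ k ≤ p.1, ‖∑ i ∈ Finset.range k, f (ξ i) • (g (t (i + 1)) - g (t i))
      - f (t k) • g (t k)‖ ≤ (|f a| + (f (t k) - f a)) * M := by
    intro k
    induction k with
    | zero =>
      intro _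
      simp only [Finset.range_zero, Finset.sum_empty, zero_sub, norm_neg, norm_smul,
        Real.norm_eq_abs, h0, sub_self, add_zero]
      have := hg 0 (Nat.zero_le _)
      rw [h0] at this
      gcongr
    | succ k ih =>
      intro hk
      have e : ∑ i ∈ Finset.range (k + 1), f (ξ i) • (g (t (i + 1)) - g (t i))
          - f (t (k + 1)) • g (t (k + 1)) =
          (∑ i ∈ Finset.range k, f (ξ i) • (g (t (i + 1)) - g (t i)) - f (t k) • g (t k))
          + (-((f (t (k + 1)) - f (ξ k)) • g (t (k + 1))) - (f (ξ k) - f (t k)) • g (t k)) := by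
        rw [Finset.sum_range_succ]
        module
      have i1 : 0 ≤ f (t (k + 1)) - f (ξ k) := sub_nonneg.2 (hf (h2 k (by omega)).2.1)
      have i2 : 0 ≤ f (ξ k) - f (t k) := sub_nonneg.2 (hf (h2 k (by omega)).1)
      rw [e]
      have j1 : ‖(f (t (k + 1)) - f (ξ k)) • g (t (k + 1))‖ ≤ (f (t (k + 1)) - f (ξ k)) * M := by
        rw [norm_smul, Real.norm_of_nonneg i1]
        exact mul_le_mul_of_nonneg_left (hg _ hk) i1
      have j2 : ‖(f (ξ k) - f (t k)) • g (t k)‖ ≤ (f (ξ k) - f (t k)) * M := by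
        rw [norm_smul, Real.norm_of_nonneg i2]
        exact mul_le_mul_of_nonneg_left (hg _ (by omega)) i2
      refine (norm_add_le _ _).trans ((add_le_add (ih (by omega)) (norm_sub_le _ _)).trans ?_)
      rw [norm_neg]
      linarith
  have hk := key p.1 le_rfl
  rw [h1] at hk
  have hb : ‖f b • g b‖ ≤ |f b| * M := by
    rw [norm_smul, Real.norm_eq_abs]
    have := hg p.1 le_rfl
    rw [h1] at this
    gcongr
  have e : rsSum f g p = (rsSum f g p - f b • g b) + f b • g b := by abel
  rw [e]
  refine (norm_add_le _ _).trans ((add_le_add hk hb).trans ?_)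
  have : |f a| + (f b - f a) + |f b| ≤ 2 * (|f a| + |f b|) := by
    linarith [le_abs_self (f b), neg_abs_le (f a)]
  calc (|f a| + (f b - f a)) * M + |f b| * M = (|f a| + (f b - f a) + |f b|) * M := by ring
    _ ≤ _ := by gcongr

lemma norm_rsSum_le {f : ℝ≥0 → ℝ} (hf : Monotone f ∨ Antitone f) {g : ℝ≥0 → E} {a b δ : ℝ≥0}
    {p : TaggedPartition} (hp : p ∈ finePartitions a b δ) {M : ℝ}
    (hM : ∀ t, a ≤ t → t ≤ b → ‖g t‖ ≤ M) :
    ‖rsSum f g p‖ ≤ 2 * (|f a| + |f b|) * M := by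
  rcases hf with hf | hf
  · exact norm_rsSum_le_of_monotone hf hp hM
  · have := norm_rsSum_le_of_monotone (f := fun x => - f x) (fun x y h => neg_le_neg (hf h)) hp hM
    simpa [rsSum] using this

lemma rsSum_add (f : ℝ≥0 → ℝ) (g h : ℝ≥0 → E) (p : TaggedPartition) :
    rsSum f (fun t => g t + h t) p = rsSum f g p + rsSum f h p := by
  simp only [rsSum, ← Finset.sum_add_distrib]
  refine Finset.sum_congr rfl fun i _ => ?_
  module

lemma rsSum_sub (f : ℝ≥0 → ℝ) (g h : ℝ≥0 → E) (p : TaggedPartition) :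
    rsSum f (fun t => g t - h t) p = rsSum f g p - rsSum f h p := by
  simp only [rsSum, ← Finset.sum_sub_distrib]
  refine Finset.sum_congr rfl fun i _ => ?_
  module

/-- Functions with a Riemann–Stieltjes integral on each interval, for every continuous
integrand. -/
def IsRSIntegrator (h : ℝ≥0 → E) : Prop :=
  ∀ f : ℝ≥0 → ℝ, Continuous f → ∀ a b : ℝ≥0, ∃ x, HasRSIntegral f h a b x

lemma IsRSIntegrator.add {g h : ℝ≥0 → E} (hg : IsRSIntegrator g) (hh : IsRSIntegrator h) :
    IsRSIntegrator (fun t => g t + h t) := by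
  intro f hf a b
  obtain ⟨x, hx⟩ := hg f hf a b
  obtain ⟨y, hy⟩ := hh f hf a b
  refine ⟨x + y, ?_⟩
  rw [hasRSIntegral_iff_tendsto] at *
  simpa only [funext (rsSum_add f g h)] using hx.add hy

lemma isRSIntegrator_const (v : E) : IsRSIntegrator (fun _ => v) := fun f _ a b => by
  refine ⟨0, ?_⟩
  rw [hasRSIntegral_iff_tendsto]
  have : rsSum f (fun _ => v) = fun _ => 0 := by ext; simp [rsSum]
  rw [this]
  exact tendsto_const_nhds

/-- Only the partition interval straddling c contributes, and its tag is close to c, so continuity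
of f gives the value f(c)v when a < c ≤ b and 0 otherwise. -/
lemma isRSIntegrator_jump (c : ℝ≥0) (v : E) :
    IsRSIntegrator (fun t => if c ≤ t then v else 0) := by
  intro f hf a b
  by_cases hac : c ≤ a
  · refine ⟨0, fun ε hε => ⟨1, one_pos, fun n t ξ h0 h1 h2 => ?_⟩⟩
    have hp : ((n, t, ξ) : TaggedPartition) ∈ finePartitions a b 1 := ⟨h0, h1, h2⟩
    rw [Finset.sum_eq_zero]
    · simpa using hε
    · intro i hi
      have hi := Finset.mem_range.1 hi
      beta_reduce
      rw [if_pos (hac.trans (finePartitions_le hp (i := i + 1) hi).1),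
        if_pos (hac.trans (finePartitions_le hp (i := i) (show i ≤ n by omega)).1)]
      simp
  by_cases hcb : c ≤ b
  swap
  · refine ⟨0, fun ε hε => ⟨1, one_pos, fun n t ξ h0 h1 h2 => ?_⟩⟩
    have hp : ((n, t, ξ) : TaggedPartition) ∈ finePartitions a b 1 := ⟨h0, h1, h2⟩
    rw [Finset.sum_eq_zero]
    · simpa using hε
    · intro i hi
      have hi := Finset.mem_range.1 hi
      beta_reduce
      rw [if_neg (fun h : c ≤ t (i + 1) => hcb (h.trans (finePartitions_le hp (i := i + 1) hi).2)),
        if_neg (fun h : c ≤ t i =>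
          hcb (h.trans (finePartitions_le hp (i := i) (show i ≤ n by omega)).2))]
      simp
  refine ⟨f c • v, fun ε hε => ?_⟩
  obtain ⟨δ, hδ, hδ'⟩ := Metric.continuousAt_iff.1
    ((hf.smul continuous_const : Continuous fun s => f s • v).continuousAt (x := c)) ε hε
  refine ⟨⟨δ / 2, by positivity⟩, by exact_mod_cast half_pos hδ, fun n t ξ h0 h1 h2 => ?_⟩
  have key : ∀ k ≤ n, (t k < c →
      ∑ i ∈ Finset.range k, f (ξ i) • ((if c ≤ t (i + 1) then v else 0)
        - (if c ≤ t i then v else 0)) = 0) ∧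
      (c ≤ t k → ‖∑ i ∈ Finset.range k, f (ξ i) • ((if c ≤ t (i + 1) then v else 0)
        - (if c ≤ t i then v else 0)) - f c • v‖ < ε) := by
    intro k
    induction k with
    | zero =>
      intro _
      exact ⟨fun _ => by simp, fun h => absurd (h0 ▸ h) hac⟩
    | succ k ih =>
      intro hk
      obtain ⟨a1, a2, a3⟩ := h2 k (by omega)
      rw [Finset.sum_range_succ]
      refine ⟨fun h => ?_, fun h => ?_⟩
      · have h' : t k < c := (a1.trans a2).trans_lt h
        rw [(ih (by omega)).1 h', if_neg h.not_ge, if_neg h'.not_ge]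
        simp
      · by_cases h' : c ≤ t k
        · rw [if_pos h, if_pos h']
          simpa using (ih (by omega)).2 h'
        · push Not at h'
          rw [(ih (by omega)).1 h', if_pos h, if_neg h'.not_ge, zero_add, sub_zero, ← dist_eq_norm]
          apply hδ'
          have b1 : (t k : ℝ) ≤ ξ k := a1
          have b2 : (ξ k : ℝ) ≤ t (k + 1) := a2
          have b3 : (t (k + 1) : ℝ) ≤ t k + δ / 2 := a3
          have b4 : (t k : ℝ) < c := h'
          have b5 : (c : ℝ) ≤ t (k + 1) := h
          rw [NNReal.dist_eq, abs_lt]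
          constructor <;> linarith
  exact (key n le_rfl).2 (h1 ▸ hcb)

/-- Càdlàg functions are locally uniform limits of step functions. -/
lemma IsCadlag.exists_step_approx {g : ℝ≥0 → E} (hg : IsCadlag g) {ε : ℝ} (hε : 0 < ε) (b : ℝ≥0) :
    ∃ h : ℝ≥0 → E, (∀ t ≤ b, ‖g t - h t‖ ≤ ε) ∧ IsRSIntegrator h ∧ ∃ M, ∀ t, ‖h t‖ ≤ M := by
  -- The approximant stays frozen at g(c) after c, so a single added jump extends it.
  let Q : ℝ≥0 → Prop := fun c => ∃ h : ℝ≥0 → E, (∀ t ≤ c, ‖g t - h t‖ ≤ ε) ∧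
    (∀ t, c ≤ t → h t = g c) ∧ IsRSIntegrator h ∧ ∃ M, ∀ t, ‖h t‖ ≤ M
  have extend : ∀ c d : ℝ≥0, c ≤ d → Q c → (∀ t, c ≤ t → t < d → ‖g t - g c‖ ≤ ε) → Q d := by
    rintro c d hcd ⟨h, h1, h2, h3, M, hM⟩ hosc
    refine ⟨fun t => h t + if d ≤ t then g d - g c else 0, fun t ht => ?_, fun t ht => ?_,
      h3.add (isRSIntegrator_jump d _), M + ‖g d - g c‖, fun t => ?_⟩
    · beta_reduce
      rcases lt_or_eq_of_le ht with hlt | rfl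
      · rw [if_neg hlt.not_ge, add_zero]
        rcases le_total t c with htc | htc
        · exact h1 t htc
        · rw [h2 t htc]
          exact hosc t htc hlt
      · rw [if_pos le_rfl, h2 t hcd]
        simpa using hε.le
    · beta_reduce
      rw [if_pos ht, h2 t (hcd.trans ht)]
      abel
    · refine (norm_add_le _ _).trans (add_le_add (hM t) ?_)
      split_ifs
      · exact le_rfl
      · simp
  suffices ∀ b, Q b by
    obtain ⟨h, h1, -, h3, h4⟩ := this b
    exact ⟨h, h1, h3, h4⟩
  intro b
  have Q0 : Q 0 := ⟨fun _ => g 0, fun t ht => by simp [nonpos_iff_eq_zero.1 ht, hε.le],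
    fun _ _ => rfl, isRSIntegrator_const _, ‖g 0‖, fun _ => le_rfl⟩
  -- Continuous induction: the left limit puts the supremum itself into S, and right continuity
  -- moves past it unless it equals b.
  let S : Set ℝ≥0 := {c | c ≤ b ∧ Q c}
  have hS0 : (0 : ℝ≥0) ∈ S := ⟨zero_le, Q0⟩
  have hSb : BddAbove S := ⟨b, fun c hc => hc.1⟩
  set s := sSup S with hs
  have hsb : s ≤ b := csSup_le ⟨0, hS0⟩ fun c hc => hc.1
  have Qs : Q s := by
    obtain ⟨l, hl⟩ := (hg s).2
    have h1 : ∀ᶠ t in 𝓝[<] s, ‖g t - l‖ < ε / 2 := by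
      simpa [dist_eq_norm] using hl.eventually (Metric.ball_mem_nhds l (half_pos hε))
    rcases eq_or_ne s 0 with h0 | h0
    · rw [h0]; exact Q0
    obtain ⟨r, hr, hr'⟩ := (mem_nhdsLT_iff_exists_Ioo_subset' (pos_iff_ne_zero.2 h0)).1 h1
    obtain ⟨c, hcS, hrc⟩ := exists_lt_of_lt_csSup ⟨0, hS0⟩ (show r < s from hr)
    have hcs : c ≤ s := le_csSup hSb hcS
    rcases eq_or_lt_of_le hcs with h | h
    · rw [← h]; exact hcS.2
    · refine extend c s hcs hcS.2 fun t ht hts => ?_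
      have e1 : ‖g t - l‖ < ε / 2 := hr' ⟨hrc.trans_le ht, hts⟩
      have e2 : ‖g c - l‖ < ε / 2 := hr' ⟨hrc, h⟩
      calc ‖g t - g c‖ = ‖(g t - l) - (g c - l)‖ := by congr 1; abel
        _ ≤ ‖g t - l‖ + ‖g c - l‖ := norm_sub_le _ _
        _ ≤ ε := by linarith
  rcases eq_or_lt_of_le hsb with h | h
  · rw [← h]; exact Qs
  exfalso
  have h1 : ∀ᶠ t in 𝓝[≥] s, ‖g t - g s‖ < ε := by
    simpa [dist_eq_norm] using
      (hg s).1.eventually (Metric.ball_mem_nhds (g s) hε)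
  obtain ⟨r, hr, hr'⟩ := (mem_nhdsGE_iff_exists_Ico_subset' h).1 h1
  have hsr : s < min r b := lt_min hr h
  have : Q (min r b) := extend s _ hsr.le Qs fun t ht htr =>
    (hr' ⟨ht, htr.trans_le (min_le_left _ _)⟩ : ‖g t - g s‖ < ε).le
  exact absurd (le_csSup hSb (show min r b ∈ S from ⟨min_le_right _ _, this⟩)) hsr.not_ge

lemma IsCadlag.bounded {g : ℝ≥0 → E} (hg : IsCadlag g) (b : ℝ≥0) :
    ∃ M : ℝ, ∀ t ≤ b, ‖g t‖ ≤ M := by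
  obtain ⟨h, h1, -, M, hM⟩ := hg.exists_step_approx one_pos b
  refine ⟨1 + M, fun t ht => ?_⟩
  calc ‖g t‖ = ‖(g t - h t) + h t‖ := by simp
    _ ≤ _ := (norm_add_le _ _).trans (add_le_add (h1 t ht) (hM t))

/-- A càdlàg function is a Riemann–Stieltjes integrator for continuous monotone integrands. -/
theorem IsCadlag.exists_hasRSIntegral [CompleteSpace E] {g : ℝ≥0 → E} (hg : IsCadlag g)
    {f : ℝ≥0 → ℝ} (hf : Monotone f ∨ Antitone f) (hfc : Continuous f) {a b : ℝ≥0} (hab : a ≤ b) :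
    ∃ x, HasRSIntegral f g a b x := by
  simp_rw [hasRSIntegral_iff_tendsto]
  have := meshFilter_neBot hab
  refine CompleteSpace.complete (f := map (rsSum f g) (meshFilter a b)) ?_
  rw [Metric.cauchy_iff]
  refine ⟨inferInstance, fun ε hε => ?_⟩
  set C := 2 * (|f a| + |f b|)
  have hC : 0 ≤ C := by positivity
  -- Summation by parts multiplies the approximation error by C; the added 1 covers C = 0.
  obtain ⟨h, h1, h2, -⟩ := hg.exists_step_approx (ε := ε / (4 * (C + 1))) (by positivity) b
  obtain ⟨x, hx⟩ := h2 f hfc a b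
  rw [hasRSIntegral_iff_tendsto] at hx
  refine ⟨Metric.ball x (ε / 2), ?_, fun y hy z hz => ?_⟩
  · have hfine : finePartitions a b 1 ∈ meshFilter a b :=
      (meshFilter_hasBasis a b).mem_of_mem (i := ⟨1, one_pos⟩) trivial
    rw [mem_map]
    filter_upwards [hx (Metric.ball_mem_nhds x (show 0 < ε / 4 by positivity)), hfine]
      with p hp hp'
    have hb := norm_rsSum_le hf hp' (g := fun t => g t - h t) (fun t _ ht => h1 t ht)
    rw [rsSum_sub] at hb
    have hb' : C * (ε / (4 * (C + 1))) ≤ ε / 4 := by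
      rw [mul_div_assoc', div_le_div_iff₀ (by positivity) (by positivity)]
      nlinarith
    have hp2 : ‖rsSum f h p - x‖ < ε / 4 := by simpa [dist_eq_norm] using hp
    rw [Set.mem_preimage, Metric.mem_ball, dist_eq_norm]
    calc ‖rsSum f g p - x‖ = ‖(rsSum f g p - rsSum f h p) + (rsSum f h p - x)‖ := by
          congr 1; abel
      _ ≤ _ := norm_add_le _ _
      _ < ε / 2 := by linarith
  · calc dist y z ≤ dist y x + dist z x := dist_triangle_right _ _ _
      _ < ε := by linarith [Metric.mem_ball.1 hy, Metric.mem_ball.1 hz]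

lemma HasRSIntegral.norm_le {f : ℝ≥0 → ℝ} {g : ℝ≥0 → E} {a b : ℝ≥0} {x : E}
    (h : HasRSIntegral f g a b x) (hf : Monotone f ∨ Antitone f) (hab : a ≤ b) {M : ℝ}
    (hM : ∀ t, a ≤ t → t ≤ b → ‖g t‖ ≤ M) :
    ‖x‖ ≤ 2 * (|f a| + |f b|) * M := by
  rw [hasRSIntegral_iff_tendsto] at h
  have := meshFilter_neBot hab
  refine le_of_tendsto h.norm ?_
  have hfine : finePartitions a b 1 ∈ meshFilter a b :=
    (meshFilter_hasBasis a b).mem_of_mem (i := ⟨1, one_pos⟩) trivial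
  filter_upwards [hfine] with p hp
  exact norm_rsSum_le hf hp hM

lemma HasRSIntegral.unique {f : ℝ≥0 → ℝ} {g : ℝ≥0 → E} {a b : ℝ≥0} {x y : E}
    (h : HasRSIntegral f g a b x) (h' : HasRSIntegral f g a b y) (hab : a ≤ b) : x = y := by
  rw [hasRSIntegral_iff_tendsto] at h h'
  have := meshFilter_neBot hab
  exact tendsto_nhds_unique h h'

lemma HasRSIntegral.tendsto_uniformPartition {f : ℝ≥0 → ℝ} {g : ℝ≥0 → E} {a b : ℝ≥0} {x : E}
    (h : HasRSIntegral f g a b x) (hab : a ≤ b) :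
    Tendsto (fun N => rsSum f g (uniformPartition a b N)) atTop (𝓝 x) :=
  (hasRSIntegral_iff_tendsto.1 h).comp (RandomIntegral.tendsto_uniformPartition hab)

lemma exists_append_partition {a b c δ : ℝ≥0} {p q : TaggedPartition}
    (hp : p ∈ finePartitions a b δ) (hq : q ∈ finePartitions b c δ) :
    ∃ r ∈ finePartitions a c δ, ∀ (f : ℝ≥0 → ℝ) (g : ℝ≥0 → E),
      rsSum f g r = rsSum f g p + rsSum f g q := by
  obtain ⟨n, t, ξ⟩ := p
  obtain ⟨m, t', ξ'⟩ := q
  obtain ⟨p0, p1, p2⟩ := hp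
  obtain ⟨q0, q1, q2⟩ := hq
  simp only at p0 p1 p2 q0 q1 q2
  have hT : ∀ j, (if n + j ≤ n then t (n + j) else t' (n + j - n)) = t' j := by
    intro j
    rcases Nat.eq_zero_or_pos j with rfl | hj
    · simp [p1, q0]
    · rw [if_neg (by omega)]; simp
  refine ⟨(n + m, fun i => if i ≤ n then t i else t' (i - n),
    fun i => if i < n then ξ i else ξ' (i - n)), ⟨by simpa using p0, ?_, ?_⟩, fun f g => ?_⟩
  · simp only [hT, q1]
  · intro i hi
    simp only at hi ⊢
    rcases lt_or_ge i n with h | h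
    · rw [if_pos h.le, if_pos h, if_pos (show i + 1 ≤ n from h)]
      exact p2 i h
    · obtain ⟨j, rfl⟩ := Nat.exists_eq_add_of_le h
      rw [hT, add_assoc, hT, if_neg (by omega)]
      simpa using q2 j (by omega)
  · simp only [rsSum]
    rw [Finset.sum_range_add]
    congr 1
    · refine Finset.sum_congr rfl fun i hi => ?_
      have h := Finset.mem_range.1 hi
      rw [if_pos h.le, if_pos h, if_pos (show i + 1 ≤ n from h)]
    · refine Finset.sum_congr rfl fun j _ => ?_
      rw [hT, add_assoc, hT, if_neg (by omega)]
      simp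

/-- As all three integrals are assumed to exist, it suffices to test them on concatenated
partitions. -/
lemma HasRSIntegral.eq_add {f : ℝ≥0 → ℝ} {g : ℝ≥0 → E} {a b c : ℝ≥0} {x y z : E}
    (hab : a ≤ b) (hbc : b ≤ c) (hx : HasRSIntegral f g a b x) (hy : HasRSIntegral f g b c y)
    (hz : HasRSIntegral f g a c z) : z = x + y := by
  refine eq_of_forall_dist_le fun ε hε => ?_
  rw [hasRSIntegral_iff_tendsto] at hx hy hz
  have h3 : 0 < ε / 3 := by positivity
  obtain ⟨d1, -, hd1⟩ := (meshFilter_hasBasis a b).mem_iff.1 (hx (Metric.ball_mem_nhds x h3))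
  obtain ⟨d2, -, hd2⟩ := (meshFilter_hasBasis b c).mem_iff.1 (hy (Metric.ball_mem_nhds y h3))
  obtain ⟨d3, -, hd3⟩ := (meshFilter_hasBasis a c).mem_iff.1 (hz (Metric.ball_mem_nhds z h3))
  set δ : ℝ≥0 := min d1.1 (min d2.1 d3.1) with hδdef
  have hδ : 0 < δ := lt_min d1.2 (lt_min d2.2 d3.2)
  have := meshFilter_neBot hab
  have := meshFilter_neBot hbc
  obtain ⟨p, hp⟩ := Filter.nonempty_of_mem
    ((meshFilter_hasBasis a b).mem_of_mem (i := ⟨δ, hδ⟩) trivial)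
  obtain ⟨q, hq⟩ := Filter.nonempty_of_mem
    ((meshFilter_hasBasis b c).mem_of_mem (i := ⟨δ, hδ⟩) trivial)
  obtain ⟨r, hr, hsum⟩ := exists_append_partition (E := E) hp hq
  have i1 : dist (rsSum f g p) x < ε / 3 := hd1 (finePartitions_mono (min_le_left _ _) hp)
  have i2 : dist (rsSum f g q) y < ε / 3 :=
    hd2 (finePartitions_mono ((min_le_right _ _).trans (min_le_left _ _)) hq)
  have i3 : dist (rsSum f g r) z < ε / 3 :=
    hd3 (finePartitions_mono ((min_le_right _ _).trans (min_le_right _ _)) hr)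
  calc dist z (x + y) ≤ dist (rsSum f g r) z + dist (rsSum f g r) (x + y) :=
        dist_triangle_left _ _ _
    _ ≤ dist (rsSum f g r) z + (dist (rsSum f g p) x + dist (rsSum f g q) y) := by
        rw [hsum f g]; gcongr; exact dist_add_add_le _ _ _ _
    _ ≤ ε := by linarith

lemma antitone_exp_neg : Antitone fun s : ℝ≥0 => Real.exp (-(s : ℝ)) := fun _ _ h =>
  Real.exp_le_exp.2 (neg_le_neg (NNReal.coe_le_coe.2 h))

lemma continuous_exp_neg : Continuous fun s : ℝ≥0 => Real.exp (-(s : ℝ)) := by fun_prop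

/-- The integral of `e^{-s}` against a càdlàg function of growth `e^{s/2}` converges. -/
theorem IsCadlag.exists_hasImproperRSIntegral [CompleteSpace E] {g : ℝ≥0 → E} (hg : IsCadlag g)
    {K : ℝ} (hK : ∀ t : ℝ≥0, ‖g t‖ ≤ K * Real.exp (t / 2)) :
    ∃ x, HasImproperRSIntegral (fun s => Real.exp (-(s : ℝ))) g x := by
  have hK0 : 0 ≤ K := by simpa using (norm_nonneg _).trans (hK 0)
  choose F hF using fun b : ℝ≥0 =>
    hg.exists_hasRSIntegral (Or.inr antitone_exp_neg) continuous_exp_neg (zero_le : 0 ≤ b)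
  -- On [n, n+1] the integrand is at most e^{-n} and the path at most K e^{(n+1)/2}, so the pieces
  -- decay like r^n.
  set r := Real.exp (-(1 / 2))
  set C := 4 * K * Real.exp (1 / 2)
  have hr1 : r < 1 := Real.exp_zero ▸ Real.exp_lt_exp.2 (by norm_num)
  have hr0 : 0 < r := Real.exp_pos _
  have step : ∀ (n : ℕ) (b : ℝ≥0), (n : ℝ≥0) ≤ b → b ≤ n + 1 → ‖F b - F n‖ ≤ C * r ^ n := by
    intro n b h1 h2
    obtain ⟨y, hy⟩ := hg.exists_hasRSIntegral (Or.inr antitone_exp_neg) continuous_exp_neg h1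
    rw [(hF n).eq_add zero_le h1 hy (hF b), add_sub_cancel_left]
    have hM : ∀ t : ℝ≥0, (n : ℝ≥0) ≤ t → t ≤ b → ‖g t‖ ≤ K * Real.exp ((n + 1) / 2) := by
      intro t _ ht
      refine (hK t).trans ?_
      have : (t : ℝ) ≤ n + 1 := by exact_mod_cast ht.trans h2
      gcongr
    refine (hy.norm_le (Or.inr antitone_exp_neg) h1 hM).trans ?_
    have e1 : Real.exp (-(b : ℝ)) ≤ Real.exp (-(n : ℝ)) :=
      Real.exp_le_exp.2 (neg_le_neg (by exact_mod_cast h1))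
    rw [abs_of_pos (Real.exp_pos _), abs_of_pos (Real.exp_pos _)]
    have e2 : r ^ n = Real.exp (-(n : ℝ) / 2) := by
      rw [← Real.exp_nat_mul]; congr 1; ring
    have e3 : Real.exp (-(n : ℝ)) * Real.exp ((n + 1) / 2)
        = Real.exp (1 / 2) * Real.exp (-(n : ℝ) / 2) := by
      rw [← Real.exp_add, ← Real.exp_add]; congr 1; ring
    calc 2 * (Real.exp (-((n : ℝ≥0) : ℝ)) + Real.exp (-(b : ℝ))) * (K * Real.exp ((n + 1) / 2))
        ≤ 2 * (Real.exp (-(n : ℝ)) + Real.exp (-(n : ℝ))) * (K * Real.exp ((n + 1) / 2)) := by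
          rw [NNReal.coe_natCast]; gcongr
      _ = 4 * K * (Real.exp (-(n : ℝ)) * Real.exp ((n + 1) / 2)) := by ring
      _ = C * r ^ n := by rw [e3, e2]; ring
  obtain ⟨x, hx⟩ : ∃ x, Tendsto (fun n : ℕ => F n) atTop (𝓝 x) := by
    refine cauchySeq_tendsto_of_complete (cauchySeq_of_le_geometric r C hr1 fun n => ?_)
    rw [dist_comm, dist_eq_norm]
    exact step n ((n + 1 : ℕ) : ℝ≥0) (by simp) (by simp)
  refine ⟨x, F, hF, ?_⟩
  have hfl : Tendsto (fun b : ℝ≥0 => ⌊b⌋₊) atTop atTop := tendsto_nat_floor_atTop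
  have h0 : Tendsto (fun b : ℝ≥0 => F b - F (⌊b⌋₊ : ℕ)) atTop (𝓝 0) := by
    refine squeeze_zero_norm (a := fun b : ℝ≥0 => C * r ^ ⌊b⌋₊) (fun b => ?_) ?_
    · exact step _ b (Nat.floor_le zero_le) (Nat.lt_floor_add_one b).le
    · simpa using ((tendsto_pow_atTop_nhds_zero_of_lt_one hr0.le hr1).comp hfl).const_mul C
  simpa using h0.add (hx.comp hfl)

end Path

/-- Strictness ensures that times left of s go strictly left of σ(s), where the left limit of g
lives. -/
lemma IsCadlag.comp_strictMono {E : Type*} [TopologicalSpace E] {g : ℝ≥0 → E} (hg : IsCadlag g)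
    {σ : ℝ≥0 → ℝ≥0}
    (hσ : StrictMono σ) (hσc : Continuous σ) : IsCadlag fun s => g (σ s) := by
  intro s
  refine ⟨(hg (σ s)).1.comp hσc.continuousWithinAt fun t ht => hσ.monotone ht, ?_⟩
  obtain ⟨l, hl⟩ := (hg (σ s)).2
  exact ⟨l, hl.comp (tendsto_nhdsWithin_iff.2 ⟨hσc.continuousWithinAt.tendsto,
    eventually_nhdsWithin_of_forall fun t ht => hσ ht⟩)⟩

/-! ### Exponential semigroups and continuous logarithms -/

/-- Continuous multiplicative semigroups of complex numbers are exponential. -/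
lemma exists_eq_exp_of_mul {φ : ℝ≥0 → ℂ} (h0 : φ 0 = 1) (hmul : ∀ s t, φ (s + t) = φ s * φ t)
    (hc : Continuous φ) : ∃ c : ℂ, ∀ t : ℝ≥0, φ t = Complex.exp (t * c) := by
  set u : ℝ → ℂ := fun x => φ x.toNNReal with hu
  have huc : Continuous u := hc.comp continuous_real_toNNReal
  have hu0 : u 0 = 1 := by simp [hu, h0]
  have humul : ∀ s t : ℝ, 0 ≤ s → 0 ≤ t → u (s + t) = u s * u t := fun s t hs ht => by
    simp only [hu, Real.toNNReal_add hs ht, hmul]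
  -- Integrating the functional equation over [0, δ] expresses u through its primitive U, which
  -- shows that u is differentiable on [0, ∞).
  set U : ℝ → ℂ := fun x => ∫ y in (0 : ℝ)..x, u y with hU
  have hUd : ∀ x, HasDerivAt U (u x) x := fun x => huc.integral_hasStrictDerivAt 0 x |>.hasDerivAt
  have hU0 : U 0 = 0 := by simp [hU]
  obtain ⟨δ, hδU, hδ⟩ : ∃ δ : ℝ, U δ ≠ 0 ∧ 0 < δ := by
    have h1 : ∀ᶠ x in 𝓝[≠] (0 : ℝ), U x ≠ U 0 := by
      refine (hUd 0).eventually_ne ?_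
      rw [hu0]; exact one_ne_zero
    have h2 : ∀ᶠ x in 𝓝[>] (0 : ℝ), U x ≠ U 0 :=
      h1.filter_mono (nhdsWithin_mono _ fun x hx => ne_of_gt hx)
    obtain ⟨δ, h3, h4⟩ := (h2.and self_mem_nhdsWithin).exists
    exact ⟨δ, hU0 ▸ h3, h4⟩
  have key : ∀ t : ℝ, 0 ≤ t → u t * U δ = U (t + δ) - U t := by
    intro t ht
    have e1 : U (t + δ) - U t = ∫ y in t..(t + δ), u y :=
      intervalIntegral.integral_interval_sub_left (huc.intervalIntegrable _ _)
        (huc.intervalIntegrable _ _)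
    have e2 : ∫ y in t..(t + δ), u y = ∫ y in (0 : ℝ)..δ, u (t + y) := by
      rw [intervalIntegral.integral_comp_add_left (fun y => u y) t, add_zero]
    rw [e1, e2, hU]
    simp only
    rw [← intervalIntegral.integral_const_mul]
    refine intervalIntegral.integral_congr fun y hy => ?_
    rw [Set.uIcc_of_le hδ.le] at hy
    exact (humul t y ht hy.1).symm
  set c : ℂ := (u δ - 1) / U δ with hcdef
  -- For t ≥ 0 this is u(t)e^{-tc}, written with the differentiable formula; c is chosen to make its
  -- derivative zero.
  set V : ℝ → ℂ := fun t => (U (t + δ) - U t) / U δ * Complex.exp (-(t * c)) with hV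
  have hVd : ∀ t : ℝ, 0 ≤ t → HasDerivAt V 0 t := by
    intro t ht
    have d1 : HasDerivAt (fun t => (U (t + δ) - U t) / U δ) ((u (t + δ) - u t) / U δ) t :=
      (((hUd (t + δ)).comp_add_const t δ).sub (hUd t)).div_const _
    have d2 : HasDerivAt (fun t : ℝ => Complex.exp (-(t * c)))
        (Complex.exp (-(t * c)) * (-(1 * c))) t :=
      ((((hasDerivAt_id t).ofReal_comp).mul_const c).neg).cexp
    refine (d1.mul d2).congr_deriv ?_
    rw [← key t ht, humul t δ ht hδ.le, hcdef]
    field_simp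
    ring
  refine ⟨c, fun t => ?_⟩
  have hconst := constant_of_has_deriv_right_zero (f := V) (a := 0) (b := t)
    (fun x hx => (hVd x hx.1).continuousAt.continuousWithinAt)
    (fun x hx => (hVd x hx.1).hasDerivWithinAt) t ⟨t.2, le_rfl⟩
  have hVt : ∀ s : ℝ, 0 ≤ s → V s = u s * Complex.exp (-(s * c)) := fun s hs => by
    simp only [hV]
    rw [← key s hs, mul_div_cancel_right₀ _ hδU]
  rw [hVt t t.2, hVt 0 le_rfl, hu0, Complex.exp_neg] at hconst
  have hne := Complex.exp_ne_zero ((t : ℝ) * c)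
  have hut : u t = φ t := by simp [hu]
  rw [hut] at hconst
  simp only [Complex.ofReal_zero, zero_mul, neg_zero, Complex.exp_zero, mul_one] at hconst
  rw [mul_inv_eq_one₀ hne] at hconst
  exact hconst

/-- Logarithms vanishing at the origin are unique among continuous functions. -/
lemma eq_of_exp_eq {V : Type*} [AddCommGroup V] [Module ℝ V] [TopologicalSpace V]
    [ContinuousSMul ℝ V] {ψ ψ' : V → ℂ} (hψ : Continuous ψ) (hψ' : Continuous ψ')
    (h0 : ψ 0 = ψ' 0) (h : ∀ x, Complex.exp (ψ x) = Complex.exp (ψ' x)) : ψ = ψ' := by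
  ext x
  choose n hn using fun y => Complex.exp_eq_exp_iff_exists_int.1 (h y)
  have hpi : (2 * Real.pi : ℝ) ≠ 0 := by positivity
  have e : ∀ y, (n y : ℝ) = (ψ y - ψ' y).im / (2 * Real.pi) := fun y => by
    rw [hn y, eq_div_iff hpi]; simp
  -- The integer winding number is continuous along the ray through x, hence constant, and it
  -- vanishes at the origin.
  have hc : Continuous fun r : ℝ => n (r • x) := by
    rw [Int.isClosedEmbedding_coe_real.isEmbedding.isInducing.continuous_iff]
    have : (fun r : ℝ => ((n (r • x) : ℤ) : ℝ))
        = fun r : ℝ => (ψ (r • x) - ψ' (r • x)).im / (2 * Real.pi) := funext fun r => e _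
    have h2 : Continuous fun r : ℝ => (ψ (r • x) - ψ' (r • x)).im / (2 * Real.pi) := by fun_prop
    rw [← this] at h2
    exact h2
  have h1 : n ((1 : ℝ) • x) = n ((0 : ℝ) • x) := PreconnectedSpace.constant inferInstance hc
  rw [one_smul, zero_smul] at h1
  have h2 : n 0 = 0 := by
    have := e 0
    rw [h0, sub_self, Complex.zero_im, zero_div] at this
    exact_mod_cast this
  have := hn x
  rw [h1, h2] at this
  simpa using this

/-! ### Characteristic functionals of random variables -/

section CharFun

variable {E : Type*} [NormedAddCommGroup E] [NormedSpace ℝ E] [MeasurableSpace E] [BorelSpace E]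
  {Ω : Type*} [MeasurableSpace Ω] {P : Measure Ω}

lemma charFunDual_map_eq_integral {X : Ω → E} (hX : AEMeasurable X P) (L : StrongDual ℝ E) :
    charFunDual (P.map X) L = ∫ ω, Complex.exp (L (X ω) * Complex.I) ∂P := by
  rw [charFunDual_apply, integral_map hX]
  exact Measurable.aestronglyMeasurable (by fun_prop)

omit [BorelSpace E] in
lemma norm_charFunDual_le_one [IsProbabilityMeasure P] (X : Ω → E) (L : StrongDual ℝ E) :
    ‖charFunDual (P.map X) L‖ ≤ 1 := by
  rw [charFunDual_apply]
  refine (norm_integral_le_integral_norm _).trans ?_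
  simp only [Complex.norm_exp_ofReal_mul_I, integral_const, smul_eq_mul, mul_one]
  by_cases hX : AEMeasurable X P
  · have := Measure.isProbabilityMeasure_map hX
    simp
  · simp [Measure.map_of_not_aemeasurable hX]

lemma tendsto_charFunDual_map [IsProbabilityMeasure P] {ι : Type*} {l : Filter ι}
    [l.IsCountablyGenerated] {X : ι → Ω → E} {Z : Ω → E} (hX : ∀ i, AEMeasurable (X i) P)
    (hZ : AEMeasurable Z P) (h : ∀ᵐ ω ∂P, Tendsto (fun i => X i ω) l (𝓝 (Z ω)))
    (L : StrongDual ℝ E) :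
    Tendsto (fun i => charFunDual (P.map (X i)) L) l (𝓝 (charFunDual (P.map Z) L)) := by
  simp_rw [charFunDual_map_eq_integral (hX _), charFunDual_map_eq_integral hZ]
  refine tendsto_integral_filter_of_dominated_convergence (fun _ => 1)
    (Eventually.of_forall fun i => ?_) (Eventually.of_forall fun i => ?_) (integrable_const _) ?_
  · have hm : Measurable fun x : E => Complex.exp (L x * Complex.I) := by fun_prop
    exact (hm.comp_aemeasurable (hX i)).aestronglyMeasurable
  · exact Eventually.of_forall fun ω => (Complex.norm_exp_ofReal_mul_I _).le
  · filter_upwards [h] with ω hω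
    have hc : Continuous fun x : E => Complex.exp (L x * Complex.I) := by fun_prop
    exact (hc.tendsto _).comp hω

lemma continuous_charFunDual (μ : Measure E) [IsFiniteMeasure μ] :
    Continuous (charFunDual μ) := by
  have : charFunDual μ = fun L : StrongDual ℝ E => ∫ x, Complex.exp (L x * Complex.I) ∂μ :=
    funext fun L => charFunDual_apply L
  rw [this]
  refine continuous_of_dominated (bound := fun _ => 1) (fun L => ?_) (fun L => ?_)
    (integrable_const _) ?_
  · exact Measurable.aestronglyMeasurable (by fun_prop)
  · exact Eventually.of_forall fun x => (Complex.norm_exp_ofReal_mul_I _).le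
  · exact Eventually.of_forall fun x => by fun_prop

end CharFun

/-! ### The Lévy exponent -/

section Exponent

variable {E : Type*} [NormedAddCommGroup E] [NormedSpace ℝ E] [SecondCountableTopology E]
  [MeasurableSpace E] [BorelSpace E]
  {Ω : Type*} [MeasurableSpace Ω] {P : Measure Ω} [IsProbabilityMeasure P] {Y : ℝ≥0 → Ω → E}

omit [NormedSpace ℝ E] [SecondCountableTopology E] [BorelSpace E] [IsProbabilityMeasure P] in
lemma IsLevyProcess.map_sub (hY : IsLevyProcess Y P) (s h : ℝ≥0) :
    P.map (fun ω => Y (s + h) ω - Y s ω) = P.map (Y h) := by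
  rw [(hY.stationary_increments s 0 h).map_eq]
  refine Measure.map_congr ?_
  filter_upwards [hY.start_zero] with ω hω
  simp [hω]

omit [IsProbabilityMeasure P] in
lemma IsLevyProcess.charFunDual_add (hY : IsLevyProcess Y P) (s t : ℝ≥0) (L : StrongDual ℝ E) :
    charFunDual (P.map (Y (s + t))) L
      = charFunDual (P.map (Y s)) L * charFunDual (P.map (Y t)) L := by
  have hi := hY.indep_increments.indepFun_eval_sub (zero_le : 0 ≤ s) (le_self_add : s ≤ s + t)
    hY.start_zero
  have := (hY.indep_increments.nat (t := fun _ => 0) monotone_const).isProbabilityMeasure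
  have h := hi.charFunDual_map_add_eq_mul (hY.measurable s).aemeasurable
    ((hY.measurable (s + t)).sub (hY.measurable s)).aemeasurable
  have e : Y s + (Y (s + t) - Y s) = Y (s + t) := by abel
  rw [e] at h
  rw [h, Pi.mul_apply]
  congr 2
  exact hY.map_sub s t

omit [SecondCountableTopology E] in
lemma IsLevyProcess.charFunDual_zero (hY : IsLevyProcess Y P) (L : StrongDual ℝ E) :
    charFunDual (P.map (Y 0)) L = 1 := by
  have : P.map (Y 0) = P.map (fun _ => (0 : E)) := Measure.map_congr hY.start_zero
  simp [this]

/-- Right continuity of paths at time 0 suffices: by multiplicativity and the bound 1, the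
difference at times s and t is controlled by the difference at |t - s| and 0, on either side. -/
lemma IsLevyProcess.continuous_charFunDual (hY : IsLevyProcess Y P) (L : StrongDual ℝ E) :
    Continuous fun t => charFunDual (P.map (Y t)) L := by
  have h0 : Tendsto (fun t => charFunDual (P.map (Y t)) L) (𝓝 0) (𝓝 1) := by
    rw [← hY.charFunDual_zero L]
    refine tendsto_charFunDual_map (fun t => (hY.measurable t).aemeasurable)
      (hY.measurable 0).aemeasurable ?_ L
    filter_upwards [hY.cadlag] with ω hω
    have := (hω 0).1.tendsto
    rwa [show Set.Ici (0 : ℝ≥0) = Set.univ from by ext; simp, nhdsWithin_univ] at this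
  have hle : ∀ s t : ℝ≥0, s ≤ t → ‖charFunDual (P.map (Y t)) L - charFunDual (P.map (Y s)) L‖
      ≤ ‖charFunDual (P.map (Y (nndist t s))) L - 1‖ := by
    intro s t hst
    obtain ⟨h, rfl⟩ := exists_add_of_le hst
    have e : nndist (s + h) s = h := by
      rw [← NNReal.coe_inj, coe_nndist, NNReal.dist_eq]; simp
    rw [e, hY.charFunDual_add]
    calc ‖charFunDual (P.map (Y s)) L * charFunDual (P.map (Y h)) L - charFunDual (P.map (Y s)) L‖
        = ‖charFunDual (P.map (Y s)) L‖ * ‖charFunDual (P.map (Y h)) L - 1‖ := by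
          rw [← norm_mul]; congr 1; ring
      _ ≤ 1 * _ := by gcongr; exact norm_charFunDual_le_one _ _
      _ = _ := one_mul _
  rw [continuous_iff_continuousAt]
  intro t
  rw [ContinuousAt, tendsto_iff_norm_sub_tendsto_zero]
  have hd : Tendsto (fun s => nndist s t) (𝓝 t) (𝓝 0) := by
    have : Continuous fun s : ℝ≥0 => nndist s t := by fun_prop
    simpa using this.tendsto t
  have h1 : Tendsto (fun s => ‖charFunDual (P.map (Y (nndist s t))) L - 1‖) (𝓝 t) (𝓝 0) := by
    have := (h0.comp hd).sub_const 1 |>.norm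
    simpa using this
  refine squeeze_zero (fun _ => norm_nonneg _) (fun s => ?_) h1
  rcases le_total t s with h | h
  · exact hle t s h
  · rw [norm_sub_rev, nndist_comm]
    exact hle s t h

/-- The Lévy exponent. -/
theorem IsLevyProcess.exists_exponent (hY : IsLevyProcess Y P) :
    ∃ ψ : StrongDual ℝ E → ℂ, Continuous ψ ∧ ψ 0 = 0 ∧
      ∀ (t : ℝ≥0) (L : StrongDual ℝ E), charFunDual (P.map (Y t)) L = Complex.exp (t * ψ L) := by
  choose ψ hψ using fun L : StrongDual ℝ E =>
    exists_eq_exp_of_mul (hY.charFunDual_zero L) (fun s t => hY.charFunDual_add s t L)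
      (hY.continuous_charFunDual L)
  have hre : ∀ L, (ψ L).re ≤ 0 := fun L => by
    have h := norm_charFunDual_le_one (P := P) (Y 1) L
    rw [hψ L 1, Complex.norm_exp] at h
    simpa using h
  have hre' : ∀ L, (ψ L - 1).re < 0 := fun L => by
    have := hre L
    simp only [Complex.sub_re, Complex.one_re]
    linarith
  have hne : ∀ L, ψ L - 1 ≠ 0 := fun L h => by simpa [h] using hre' L
  -- The Laplace transform in t at the point 1 equals 1/(1 - ψ(L)). It is continuous in L by
  -- dominated convergence, so ψ = 1 - 1/R is continuous with no choice of logarithm branch.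
  set R : StrongDual ℝ E → ℂ := fun L => ∫ t in Set.Ioi (0 : ℝ), Complex.exp ((ψ L - 1) * t)
    with hR
  have hRe : ∀ L, R L = -1 / (ψ L - 1) := fun L => by
    simp only [hR, integral_exp_mul_complex_Ioi (hre' L) 0]
    simp
  have hψR : ∀ L, ψ L = 1 - 1 / R L := fun L => by
    rw [hRe]
    have := hne L
    field_simp
    ring
  have hRc : Continuous R := by
    refine continuous_of_dominated (bound := fun t => Real.exp (-t)) (fun L => ?_) (fun L => ?_)
      ?_ ?_
    · exact Continuous.aestronglyMeasurable (by fun_prop)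
    · refine (ae_restrict_iff' measurableSet_Ioi).2 (Eventually.of_forall fun t ht => ?_)
      rw [Complex.norm_exp]
      refine Real.exp_le_exp.2 ?_
      have h1 := hre L
      have h2 : (0 : ℝ) < t := ht
      simp only [Complex.mul_re, Complex.sub_re, Complex.one_re, Complex.ofReal_re,
        Complex.ofReal_im, mul_zero, sub_zero]
      nlinarith
    · exact integrableOn_exp_neg_Ioi 0
    · refine (ae_restrict_iff' measurableSet_Ioi).2 (Eventually.of_forall fun t ht => ?_)
      have e : (fun L => Complex.exp ((ψ L - 1) * t))
          = fun L => charFunDual (P.map (Y t.toNNReal)) L * Complex.exp (-t) := by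
        ext L
        rw [hψ L, ← Complex.exp_add, show ((t.toNNReal : ℝ≥0) : ℝ) = t from
          Real.coe_toNNReal t (le_of_lt ht)]
        congr 1; ring
      rw [e]
      have := Measure.isProbabilityMeasure_map (μ := P) (hY.measurable t.toNNReal).aemeasurable
      exact (RandomIntegral.continuous_charFunDual _).mul continuous_const
  refine ⟨ψ, ?_, ?_, fun t L => hψ L t⟩
  · have : ψ = fun L => 1 - 1 / R L := funext hψR
    rw [this]
    refine continuous_const.sub (continuous_const.div hRc fun L => ?_)
    rw [hRe]
    exact div_ne_zero (by simp) (hne L)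
  -- A single t would determine ψ(0) only modulo 2πi/t; the Laplace transform uses all t at once.
  · have h1 : ∀ t : ℝ≥0, Complex.exp (t * ψ 0) = 1 := fun t => by
      rw [← hψ]
      have := Measure.isProbabilityMeasure_map (μ := P) (hY.measurable t).aemeasurable
      simp [charFunDual_apply]
    have h2 : R 0 = ∫ t in Set.Ioi (0 : ℝ), Complex.exp ((-1 : ℂ) * t) := by
      simp only [hR]
      refine setIntegral_congr_fun measurableSet_Ioi fun t ht => ?_
      have := h1 t.toNNReal
      rw [show ((t.toNNReal : ℝ≥0) : ℝ) = t from Real.coe_toNNReal t (le_of_lt ht)] at this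
      rw [show (ψ 0 - 1) * (t : ℂ) = t * ψ 0 + (-1) * t by ring, Complex.exp_add, this, one_mul]
    rw [hψR, h2, integral_exp_mul_complex_Ioi (by simp) 0]
    simp

omit [SecondCountableTopology E] [BorelSpace E] in
/-- The law at time one determines the exponent. -/
lemma exponent_unique {μ : Measure E} {ψ ψ' : StrongDual ℝ E → ℂ} (hψ : Continuous ψ)
    (hψ' : Continuous ψ') (h0 : ψ 0 = 0) (h0' : ψ' 0 = 0)
    (h : ∀ L, charFunDual μ L = Complex.exp (ψ L))
    (h' : ∀ L, charFunDual μ L = Complex.exp (ψ' L)) : ψ = ψ' :=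
  eq_of_exp_eq hψ hψ' (h0.trans h0'.symm) fun L => (h L).symm.trans (h' L)

end Exponent

/-! ### Maximal inequalities, logarithmic moments and path growth -/

section Maximal

open scoped ENNReal

variable {E : Type*} [NormedAddCommGroup E] [SecondCountableTopology E]
  [MeasurableSpace E] [BorelSpace E] {Ω : Type*} [MeasurableSpace Ω] {P : Measure Ω}

/-- Ottaviani's maximal inequality. -/
theorem measure_exists_norm_sum_gt_le [IsProbabilityMeasure P] {D : ℕ → Ω → E}
    (hD : ∀ i, Measurable (D i)) (hind : iIndepFun D P) (N : ℕ) (a b : ℝ)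
    (hb : ∀ k ≤ N, P {ω | b < ‖∑ i ∈ Finset.Ico k N, D i ω‖} ≤ 1 / 2) :
    P {ω | ∃ k ≤ N, a + b < ‖∑ i ∈ Finset.range k, D i ω‖}
      ≤ 2 * P {ω | a < ‖∑ i ∈ Finset.range N, D i ω‖} := by
  set S : ℕ → Ω → E := fun k ω => ∑ i ∈ Finset.range k, D i ω with hS
  have hSm : ∀ k, Measurable (S k) := fun k => Finset.measurable_sum _ fun i _ => hD i
  -- The event that the level a + b is first exceeded at index k.
  set A : ℕ → Set Ω := fun k => {ω | a + b < ‖S k ω‖ ∧ ∀ j < k, ‖S j ω‖ ≤ a + b} with hA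
  have hAm : ∀ k, MeasurableSet (A k) := fun k => by
    have : A k = {ω | a + b < ‖S k ω‖} ∩ ⋂ j, ⋂ _ : j < k, {ω | ‖S j ω‖ ≤ a + b} := by
      ext ω; simp [hA]
    rw [this]
    exact (measurableSet_lt measurable_const (hSm k).norm).inter
      (MeasurableSet.iInter fun j => MeasurableSet.iInter fun _ =>
        measurableSet_le (hSm j).norm measurable_const)
  have hAd : Pairwise (Function.onFun Disjoint A) := by
    have : ∀ i j, i < j → Disjoint (A i) (A j) := fun i j hij =>
      Set.disjoint_left.2 fun ω h1 h2 => (h2.2 i hij).not_gt h1.1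
    intro i j hij
    rcases lt_or_gt_of_ne hij with h | h
    · exact this i j h
    · exact (this j i h).symm
  have hAu : {ω | ∃ k ≤ N, a + b < ‖S k ω‖} = ⋃ k ∈ Finset.range (N + 1), A k := by
    ext ω
    simp only [Set.mem_ofPred_eq, Set.mem_iUnion, Finset.mem_range, exists_prop, Nat.lt_succ_iff]
    constructor
    · rintro ⟨k, hk, h⟩
      classical
      have hex : ∃ k, a + b < ‖S k ω‖ := ⟨k, h⟩
      exact ⟨Nat.find hex, (Nat.find_min' hex h).trans hk, Nat.find_spec hex,
        fun j hj => not_lt.1 (Nat.find_min hex hj)⟩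
    · rintro ⟨k, hk, h⟩
      exact ⟨k, hk, h.1⟩
  -- A_k depends on the summands before k. Independently of it, with probability at least 1/2, the
  -- remaining sum is at most b in norm, and then the full sum still exceeds a.
  have hterm : ∀ k ≤ N, P (A k) ≤ 2 * P (A k ∩ {ω | a < ‖S N ω‖}) := by
    intro k hk
    have hI := hind.indepFun_finset (Finset.range k) (Finset.Ico k N)
      (Finset.disjoint_left.2 fun i h1 h2 => by simp at h1 h2; omega) hD
    -- Partial sums as functions of the first k coordinates, to exhibit A_k as a preimage under that
    -- block.
    set T : ℕ → (Finset.range k → E) → E := fun j x => ∑ i, if i.1 < j then x i else 0 with hT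
    have hTm : ∀ j, Measurable (T j) := fun j => Finset.measurable_sum _ fun i _ => by
      split_ifs
      · exact measurable_pi_apply i
      · exact measurable_const
    have hTS : ∀ j ≤ k, ∀ ω, T j (fun i => D i ω) = S j ω := fun j hj ω => by
      simp only [hT, hS]
      rw [Finset.sum_coe_sort (Finset.range k) (fun i => if i < j then D i ω else 0),
        ← Finset.sum_filter]
      congr 1
      ext i
      simp only [Finset.mem_filter, Finset.mem_range]
      omega
    have hU : ∀ ω, (∑ i : Finset.Ico k N, D i ω) = ∑ i ∈ Finset.Ico k N, D i ω := fun ω =>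
      Finset.sum_coe_sort (Finset.Ico k N) (fun i => D i ω)
    have hprod := hI.measure_inter_preimage_eq_mul
      {x | a + b < ‖T k x‖ ∧ ∀ j < k, ‖T j x‖ ≤ a + b} {y | ‖∑ i, y i‖ ≤ b} ?_ ?_
    rotate_left
    · have : {x | a + b < ‖T k x‖ ∧ ∀ j < k, ‖T j x‖ ≤ a + b}
          = {x | a + b < ‖T k x‖} ∩ ⋂ j, ⋂ _ : j < k, {x | ‖T j x‖ ≤ a + b} := by
        ext x; simp
      rw [this]
      exact (measurableSet_lt measurable_const (hTm k).norm).inter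
        (MeasurableSet.iInter fun j => MeasurableSet.iInter fun _ =>
          measurableSet_le (hTm j).norm measurable_const)
    · refine measurableSet_le (Measurable.norm ?_) measurable_const
      exact Finset.measurable_sum _ fun i _ => measurable_pi_apply i
    have e1 : (fun ω (i : Finset.range k) => D i ω) ⁻¹'
        {x | a + b < ‖T k x‖ ∧ ∀ j < k, ‖T j x‖ ≤ a + b} = A k := by
      ext ω
      simp only [Set.mem_preimage, Set.mem_ofPred_eq, hA, hTS k le_rfl]
      refine and_congr_right fun _ => forall_congr' fun j => forall_congr' fun hj => ?_
      rw [hTS j hj.le]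
    have e2 : (fun ω (i : Finset.Ico k N) => D i ω) ⁻¹' {y | ‖∑ i, y i‖ ≤ b}
        = {ω | b < ‖∑ i ∈ Finset.Ico k N, D i ω‖}ᶜ := by
      ext ω
      simp only [Set.mem_preimage, Set.mem_ofPred_eq, Set.mem_compl_iff, not_lt, hU]
    rw [e1, e2] at hprod
    have hm : MeasurableSet {ω | b < ‖∑ i ∈ Finset.Ico k N, D i ω‖} :=
      measurableSet_lt measurable_const (Finset.measurable_sum _ fun i _ => hD i).norm
    have hhalf : (1 / 2 : ℝ≥0∞) ≤ P {ω | b < ‖∑ i ∈ Finset.Ico k N, D i ω‖}ᶜ := by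
      rw [prob_compl_eq_one_sub hm]
      calc (1 / 2 : ℝ≥0∞) = 1 - 1 / 2 := by
            rw [one_div, ENNReal.one_sub_inv_two]
        _ ≤ _ := tsub_le_tsub_left (hb k hk) _
    have hsub : A k ∩ {ω | b < ‖∑ i ∈ Finset.Ico k N, D i ω‖}ᶜ ⊆ A k ∩ {ω | a < ‖S N ω‖} := by
      rintro ω ⟨h1, h2⟩
      refine ⟨h1, ?_⟩
      have h3 : ‖∑ i ∈ Finset.Ico k N, D i ω‖ ≤ b := not_lt.1 h2
      have h4 : S N ω = S k ω + ∑ i ∈ Finset.Ico k N, D i ω :=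
        (Finset.sum_range_add_sum_Ico _ hk).symm
      have h5 := norm_sub_le (S N ω) (∑ i ∈ Finset.Ico k N, D i ω)
      rw [h4, add_sub_cancel_right, ← h4] at h5
      have h6 := h1.1
      show a < ‖S N ω‖
      linarith
    calc P (A k) = 2 * (P (A k) * (1 / 2)) := by
          rw [mul_comm (P (A k)), ← mul_assoc, one_div,
            ENNReal.mul_inv_cancel two_ne_zero ENNReal.ofNat_ne_top, one_mul]
      _ ≤ 2 * (P (A k) * P {ω | b < ‖∑ i ∈ Finset.Ico k N, D i ω‖}ᶜ) := by gcongr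
      _ = 2 * P (A k ∩ {ω | b < ‖∑ i ∈ Finset.Ico k N, D i ω‖}ᶜ) := by rw [hprod]
      _ ≤ _ := by gcongr
  have hSN : MeasurableSet {ω | a < ‖S N ω‖} := measurableSet_lt measurable_const (hSm N).norm
  calc P {ω | ∃ k ≤ N, a + b < ‖S k ω‖} = ∑ k ∈ Finset.range (N + 1), P (A k) := by
        rw [hAu, measure_biUnion_finset (fun i _ j _ hij => hAd hij) fun k _ => hAm k]
    _ ≤ ∑ k ∈ Finset.range (N + 1), 2 * P (A k ∩ {ω | a < ‖S N ω‖}) :=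
        Finset.sum_le_sum fun k hk => hterm k (Nat.lt_succ_iff.1 (Finset.mem_range.1 hk))
    _ = 2 * P (⋃ k ∈ Finset.range (N + 1), A k ∩ {ω | a < ‖S N ω‖}) := by
        rw [← Finset.mul_sum, measure_biUnion_finset
          (fun i _ j _ hij => (hAd hij).mono Set.inter_subset_left Set.inter_subset_left)
          fun k _ => (hAm k).inter hSN]
    _ ≤ 2 * P {ω | a < ‖S N ω‖} := by
        gcongr
        exact Set.iUnion₂_subset fun k _ => Set.inter_subset_right

variable {Y : ℝ≥0 → Ω → E}

lemma IsLevyProcess.measure_norm_sub_gt (hY : IsLevyProcess Y P) (s h : ℝ≥0) (a : ℝ) :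
    P {ω | a < ‖Y (s + h) ω - Y s ω‖} = P {ω | a < ‖Y h ω‖} := by
  have hm : MeasurableSet {x : E | a < ‖x‖} := measurableSet_lt measurable_const measurable_norm
  have h1 := congrArg (fun m => m {x : E | a < ‖x‖}) (hY.map_sub s h)
  rwa [Measure.map_apply (f := fun ω => Y (s + h) ω - Y s ω)
    ((hY.measurable _).sub (hY.measurable _)) hm,
    Measure.map_apply (hY.measurable _) hm] at h1

/-- Rounding up makes the dyadic points approach t from the right, the side on which càdlàg paths
are continuous. -/
lemma exists_dyadic_tendsto {t : ℝ≥0} (ht : t ≤ 1) :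
    ∃ k : ℕ → ℕ, (∀ N, k N ≤ 2 ^ N) ∧
      Tendsto (fun N => (k N : ℝ≥0) / 2 ^ N) atTop (𝓝[≥] t) := by
  refine ⟨fun N => ⌈t * 2 ^ N⌉₊, fun N => ?_, tendsto_nhdsWithin_iff.2 ⟨?_, ?_⟩⟩
  · rw [Nat.ceil_le]
    push_cast
    calc t * 2 ^ N ≤ 1 * 2 ^ N := by gcongr
      _ = _ := one_mul _
  · have h1 : Tendsto (fun N : ℕ => t + (1 / 2 : ℝ≥0) ^ N) atTop (𝓝 t) := by
      have : Tendsto (fun N : ℕ => (1 / 2 : ℝ≥0) ^ N) atTop (𝓝 0) :=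
        NNReal.tendsto_pow_atTop_nhds_zero_of_lt_one (by
          rw [← NNReal.coe_lt_coe]; push_cast; norm_num)
      simpa using this.const_add t
    refine tendsto_of_tendsto_of_tendsto_of_le_of_le tendsto_const_nhds h1 (fun N => ?_)
      (fun N => ?_)
    · rw [le_div_iff₀ (by positivity)]
      exact Nat.le_ceil _
    · simp only
      rw [div_le_iff₀ (by positivity), add_mul, ← mul_pow]
      have : (1 / 2 * 2 : ℝ≥0) = 1 := by simp
      rw [this, one_pow]
      exact (Nat.ceil_lt_add_one zero_le).le
  · refine Eventually.of_forall fun N => ?_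
    show t ≤ _
    rw [le_div_iff₀ (by positivity)]
    exact Nat.le_ceil _

/-- The maximal inequality for increments of a Lévy process over an interval of length one. -/
theorem IsLevyProcess.measure_exists_norm_gt_le [IsProbabilityMeasure P] (hY : IsLevyProcess Y P)
    {b : ℝ} (hb : ∀ t ≤ 1, P {ω | b < ‖Y t ω‖} ≤ 1 / 2) (s : ℝ≥0) (a : ℝ) :
    P {ω | ∃ t ≤ 1, a + b < ‖Y (s + t) ω - Y s ω‖} ≤ 2 * P {ω | a < ‖Y 1 ω‖} := by
  set B : ℕ → Set Ω := fun N =>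
    {ω | ∃ k : ℕ, k ≤ 2 ^ N ∧ a + b < ‖Y (s + (k : ℝ≥0) / 2 ^ N) ω - Y s ω‖} with hB
  have hBmono : Monotone B := by
    refine monotone_nat_of_le_succ fun N => ?_
    rintro ω ⟨k, hk, h⟩
    refine ⟨2 * k, by rw [pow_succ]; omega, ?_⟩
    have : ((2 * k : ℕ) : ℝ≥0) / 2 ^ (N + 1) = k / 2 ^ N := by
      push_cast
      rw [pow_succ]
      field_simp
    rwa [this]
  have hBle : ∀ N, P (B N) ≤ 2 * P {ω | a < ‖Y 1 ω‖} := by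
    intro N
    set τ : ℕ → ℝ≥0 := fun k => s + (k : ℝ≥0) / 2 ^ N with hτ
    have hτm : Monotone τ := fun i j hij => by simp only [hτ]; gcongr
    have hτ0 : τ 0 = s := by simp [hτ]
    have hτN : τ (2 ^ N) = s + 1 := by simp [hτ]
    have hsumr : ∀ k ω, ∑ i ∈ Finset.range k, (Y (τ (i + 1)) ω - Y (τ i) ω)
        = Y (τ k) ω - Y (τ 0) ω :=
      fun k ω => Finset.sum_range_sub (fun i => Y (τ i) ω) k
    have hsumI : ∀ k ≤ 2 ^ N, ∀ ω, ∑ i ∈ Finset.Ico k (2 ^ N), (Y (τ (i + 1)) ω - Y (τ i) ω)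
        = Y (τ (2 ^ N)) ω - Y (τ k) ω := fun k hk ω => by
      rw [Finset.sum_Ico_eq_sub _ hk, hsumr, hsumr]
      abel
    have h := measure_exists_norm_sum_gt_le
      (fun i => (hY.measurable (τ (i + 1))).sub (hY.measurable (τ i)))
      (hY.indep_increments.nat hτm) (2 ^ N) a b ?_
    · simp only [Pi.sub_apply, hsumr, hτ0, hτN] at h
      rwa [hY.measure_norm_sub_gt] at h
    · intro k hk
      simp only [Pi.sub_apply, hsumI k hk]
      obtain ⟨d, hd⟩ := exists_add_of_le (hτm hk)
      rw [hd, hY.measure_norm_sub_gt]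
      refine hb d ?_
      rw [hτN] at hd
      have h1 : s + 1 = s + ((k : ℝ≥0) / 2 ^ N + d) := by rw [hd, hτ, add_assoc]
      have h2 := add_left_cancel h1
      rw [h2]
      exact le_add_self
  -- Right continuity reduces the uncountable supremum to dyadic times, almost surely; the strict
  -- inequality survives a small change of t.
  have hsub : {ω | ∃ t ≤ 1, a + b < ‖Y (s + t) ω - Y s ω‖} ≤ᵐ[P] ⋃ N, B N := by
    filter_upwards [hY.cadlag] with ω hω
    rintro ⟨t, ht, h⟩
    obtain ⟨k, hk, hkt⟩ := exists_dyadic_tendsto ht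
    have h1 : Tendsto (fun u => Y (s + u) ω) (𝓝[≥] t) (𝓝 (Y (s + t) ω)) := by
      refine (hω (s + t)).1.tendsto.comp (tendsto_nhdsWithin_iff.2 ⟨?_, ?_⟩)
      · exact ((continuous_const.add continuous_id).tendsto t).mono_left nhdsWithin_le_nhds
      · exact eventually_nhdsWithin_of_forall fun u (hu : t ≤ u) => by
          show s + t ≤ s + u
          gcongr
    have h2 := ((h1.comp hkt).sub_const (Y s ω)).norm
    obtain ⟨N, hN⟩ := (h2.eventually (lt_mem_nhds h)).exists
    exact Set.mem_iUnion.2 ⟨N, k N, hk N, hN⟩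
  calc _ ≤ P (⋃ N, B N) := measure_mono_ae hsub
    _ = ⨆ N, P (B N) := hBmono.measure_iUnion
    _ ≤ _ := iSup_le hBle

variable [NormedSpace ℝ E]

/-- Otherwise some times t_n ≤ 1 have P(‖Y(t_n)‖ > n+1) > 1/2, while boundedness of paths on [0,1]
forces Y(t_n)/(n+1) → 0 almost surely, hence in probability. -/
lemma IsLevyProcess.exists_measure_norm_gt_le_half [IsProbabilityMeasure P]
    (hY : IsLevyProcess Y P) :
    ∃ b : ℝ, 0 ≤ b ∧ ∀ t ≤ 1, P {ω | b < ‖Y t ω‖} ≤ 1 / 2 := by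
  by_contra! h
  choose t ht ht' using fun n : ℕ => h ((n : ℝ) + 1) (by positivity)
  have hlim : ∀ᵐ ω ∂P, Tendsto (fun n : ℕ => ((n : ℝ) + 1)⁻¹ • Y (t n) ω) atTop (𝓝 0) := by
    filter_upwards [hY.cadlag] with ω hω
    obtain ⟨M, hM⟩ := hω.bounded 1
    have h1 : Tendsto (fun n : ℕ => ((n : ℝ) + 1)⁻¹ * M) atTop (𝓝 0) := by
      have := (tendsto_one_div_add_atTop_nhds_zero_nat (𝕜 := ℝ)).mul_const M
      simpa using this
    refine squeeze_zero_norm (fun n => ?_) h1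
    rw [norm_smul, Real.norm_of_nonneg (by positivity)]
    gcongr
    exact hM _ (ht n)
  have h1 := tendstoInMeasure_of_tendsto_ae (μ := P)
    (fun n => ((hY.measurable (t n)).const_smul (((n : ℝ) + 1)⁻¹)).aestronglyMeasurable) hlim
  have h2 := h1 1 one_pos
  have h3 : ∀ n : ℕ, (1 / 2 : ℝ≥0∞) ≤
      P {ω | 1 ≤ edist ((((n : ℝ) + 1)⁻¹ • Y (t n)) ω) 0} := fun n => by
    refine (ht' n).le.trans (measure_mono fun ω hω => ?_)
    have h4 : (n : ℝ) + 1 < ‖Y (t n) ω‖ := hω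
    show 1 ≤ edist _ _
    rw [edist_dist, dist_zero_right, Pi.smul_apply, norm_smul,
      Real.norm_of_nonneg (by positivity), ENNReal.one_le_ofReal, inv_mul_eq_div,
      one_le_div (by positivity)]
    exact h4.le
  have h5 : (1 / 2 : ℝ≥0∞) ≤ 0 := ge_of_tendsto h2 (Eventually.of_forall h3)
  simp at h5

omit [SecondCountableTopology E] [NormedSpace ℝ E] in
/-- A variable whose tails are dominated by those of a variable with finite logarithmic moment has
itself a finite logarithmic moment. -/
lemma integrable_log_of_tail_le [IsProbabilityMeasure P] {I X : Ω → E} (hI : AEMeasurable I P)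
    {C b : ℝ} (hC : 1 ≤ C) (hb : 0 ≤ b)
    (htail : ∀ a : ℝ, 0 ≤ a → P {ω | C * (a + b) < ‖I ω‖} ≤ 2 * P {ω | a < ‖X ω‖})
    (hint : Integrable (fun ω => Real.log (1 + ‖X ω‖)) P) :
    Integrable (fun ω => Real.log (1 + ‖I ω‖)) P := by
  have hC0 : 0 < C := by linarith
  -- The excess of ‖I‖/C over b; its tails at nonnegative levels are at most twice those of ‖X‖, so
  -- the layer-cake formula bounds its logarithmic moment.
  set W : Ω → ℝ := fun ω => max (‖I ω‖ / C - b) 0 with hW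
  have hWm : AEMeasurable W P := ((hI.norm.div_const C).sub_const b).max aemeasurable_const
  have hW0 : ∀ ω, 0 ≤ W ω := fun ω => le_max_right _ _
  have hlogW : AEMeasurable (fun ω => Real.log (1 + W ω)) P :=
    Real.measurable_log.comp_aemeasurable (hWm.const_add 1)
  have hWint : Integrable (fun ω => Real.log (1 + W ω)) P := by
    refine (lintegral_ofReal_ne_top_iff_integrable hlogW.aestronglyMeasurable
      (Eventually.of_forall fun ω => Real.log_nonneg (by linarith [hW0 ω]))).1 ?_
    have hfin : ∫⁻ ω, ENNReal.ofReal (Real.log (1 + ‖X ω‖)) ∂P ≠ ⊤ :=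
      (lintegral_ofReal_ne_top_iff_integrable hint.aestronglyMeasurable
        (Eventually.of_forall fun ω => Real.log_nonneg (by linarith [norm_nonneg (X ω)]))).2 hint
    rw [lintegral_eq_lintegral_meas_lt P
      (Eventually.of_forall fun ω => Real.log_nonneg (by linarith [norm_nonneg (X ω)]))
      hint.aemeasurable] at hfin
    rw [lintegral_eq_lintegral_meas_lt P
      (Eventually.of_forall fun ω => Real.log_nonneg (by linarith [hW0 ω])) hlogW]
    refine ne_top_of_le_ne_top (ENNReal.mul_ne_top (ENNReal.ofNat_ne_top (n := 2)) hfin) ?_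
    rw [← lintegral_const_mul' _ _ ENNReal.ofNat_ne_top]
    refine setLIntegral_mono' measurableSet_Ioi fun t ht => ?_
    have ht0 : (0 : ℝ) < t := ht
    have he : 0 ≤ Real.exp t - 1 := by linarith [Real.add_one_le_exp t]
    calc P {ω | t < Real.log (1 + W ω)} ≤ P {ω | C * ((Real.exp t - 1) + b) < ‖I ω‖} := by
          refine measure_mono fun ω hω => ?_
          have h1 : Real.exp t < 1 + W ω := by
            rwa [Set.mem_ofPred_eq, Real.lt_log_iff_exp_lt (by linarith [hW0 ω])] at hω
          have h2 : Real.exp t - 1 < W ω := by linarith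
          have h3 : Real.exp t - 1 < ‖I ω‖ / C - b := by
            rcases lt_max_iff.1 h2 with h | h
            · exact h
            · linarith
          show C * ((Real.exp t - 1) + b) < ‖I ω‖
          rw [mul_comm, ← lt_div_iff₀ hC0]
          linarith
      _ ≤ 2 * P {ω | Real.exp t - 1 < ‖X ω‖} := htail _ he
      _ ≤ 2 * P {ω | t < Real.log (1 + ‖X ω‖)} := by
          refine mul_le_mul_right (measure_mono fun ω (hω : Real.exp t - 1 < ‖X ω‖) => ?_) _
          show t < Real.log (1 + ‖X ω‖)
          rw [Real.lt_log_iff_exp_lt (by linarith [norm_nonneg (X ω)])]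
          linarith
  -- Take logarithms in 1 + ‖I‖ ≤ C(1+b)(1+W), which uses C ≥ 1.
  refine ((integrable_const (Real.log C + Real.log (1 + b))).add hWint).mono'
    (Real.measurable_log.comp_aemeasurable (hI.norm.const_add 1)).aestronglyMeasurable
    (Eventually.of_forall fun ω => ?_)
  rw [Real.norm_of_nonneg (Real.log_nonneg (by linarith [norm_nonneg (I ω)])), Pi.add_apply,
    ← Real.log_mul hC0.ne' (by linarith), ← Real.log_mul (by positivity) (by linarith [hW0 ω])]
  refine Real.log_le_log (by linarith [norm_nonneg (I ω)]) ?_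
  have h1 : ‖I ω‖ ≤ C * (b + W ω) := by
    have : ‖I ω‖ / C - b ≤ W ω := le_max_left _ _
    rw [mul_comm, ← div_le_iff₀ hC0]
    linarith
  have h2 : 0 ≤ C * b * W ω := by have := hW0 ω; positivity
  nlinarith

/-- Paths of a Lévy process with finite logarithmic moment grow slower than `e^{t/2}`. -/
theorem IsLevyProcess.ae_exists_norm_le [IsProbabilityMeasure P] (hY : IsLevyProcess Y P)
    (hint : Integrable (fun ω => Real.log (1 + ‖Y 1 ω‖)) P) :
    ∀ᵐ ω ∂P, ∃ K : ℝ, ∀ t : ℝ≥0, ‖Y t ω‖ ≤ K * Real.exp (t / 2) := by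
  obtain ⟨b, hb0, hb⟩ := hY.exists_measure_norm_gt_le_half
  -- Borel–Cantelli events. By the maximal inequality their probabilities are at most 2 P(‖Y(1)‖ >
  -- e^{n/2} - 1) = 2 P(2 log(1+‖Y(1)‖) > n), a summable bound.
  set B : ℕ → Set Ω := fun n =>
    {ω | ∃ t ≤ 1, (Real.exp (n / 2) - 1) + b < ‖Y (n + t) ω - Y n ω‖}
  have hsum : ∑' n, P (B n) ≠ ⊤ := by
    have h1 : ∑' n : ℕ, P {ω | 2 * Real.log (1 + ‖Y 1 ω‖) ∈ Set.Ioi (n : ℝ)} < ⊤ := by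
      let _ : MeasureSpace Ω := ⟨P⟩
      have : IsProbabilityMeasure (volume : Measure Ω) := ‹IsProbabilityMeasure P›
      exact tsum_prob_mem_Ioi_lt_top (hint.const_mul 2) fun ω =>
        mul_nonneg zero_le_two (Real.log_nonneg (by linarith [norm_nonneg (Y 1 ω)]))
    refine ne_top_of_le_ne_top (ENNReal.mul_ne_top (ENNReal.ofNat_ne_top (n := 2)) h1.ne) ?_
    rw [← ENNReal.tsum_mul_left]
    refine ENNReal.tsum_le_tsum fun n => (hY.measure_exists_norm_gt_le hb n _).trans ?_
    refine mul_le_mul_right (measure_mono fun ω (hω : Real.exp (n / 2) - 1 < ‖Y 1 ω‖) => ?_) _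
    show (n : ℝ) < 2 * Real.log (1 + ‖Y 1 ω‖)
    have : (n : ℝ) / 2 < Real.log (1 + ‖Y 1 ω‖) := by
      rw [Real.lt_log_iff_exp_lt (by linarith [norm_nonneg (Y 1 ω)])]
      linarith
    linarith
  filter_upwards [ae_eventually_notMem hsum, hY.cadlag] with ω hω hcad
  obtain ⟨n₀, hn₀⟩ := eventually_atTop.1 hω
  obtain ⟨M, hM⟩ := hcad.bounded n₀
  have hinc : ∀ n : ℕ, n₀ ≤ n → ∀ t : ℝ≥0, t ≤ 1 →
      ‖Y (n + t) ω - Y n ω‖ ≤ (1 + b) * Real.exp (n / 2) := by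
    intro n hn t ht
    have h1 : ¬ ((Real.exp (n / 2) - 1) + b < ‖Y (n + t) ω - Y n ω‖) := fun h =>
      hn₀ n hn ⟨t, ht, h⟩
    have h2 : (1 : ℝ) ≤ Real.exp (n / 2) := Real.one_le_exp (by positivity)
    nlinarith
  -- With this K an increment over a unit interval adds at most half of K e^{n/2}; the induction
  -- closes because 3/2 ≤ e^{1/2}.
  set K := max M (2 * (1 + b))
  have hK0 : 0 ≤ K := le_max_of_le_right (by linarith)
  have hbK : 1 + b ≤ K / 2 := by linarith [le_max_right M (2 * (1 + b))]
  have hnext : ∀ n : ℕ, n₀ ≤ n → ‖Y n ω‖ ≤ K * Real.exp (n / 2) → ∀ t : ℝ≥0, t ≤ 1 →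
      ‖Y (n + t) ω‖ ≤ 3 / 2 * K * Real.exp (n / 2) := by
    intro n hn hYn t ht
    calc ‖Y (n + t) ω‖ = ‖Y n ω + (Y (n + t) ω - Y n ω)‖ := by congr 1; abel
      _ ≤ K * Real.exp (n / 2) + (1 + b) * Real.exp (n / 2) :=
          (norm_add_le _ _).trans (add_le_add hYn (hinc n hn t ht))
      _ = (K + (1 + b)) * Real.exp (n / 2) := by ring
      _ ≤ _ := by gcongr; linarith
  have hint' : ∀ n : ℕ, n₀ ≤ n → ‖Y n ω‖ ≤ K * Real.exp (n / 2) := by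
    intro n hn
    induction n, hn using Nat.le_induction with
    | base =>
      refine (hM n₀ le_rfl).trans ((le_max_left _ _).trans (le_mul_of_one_le_right hK0 ?_))
      exact Real.one_le_exp (by positivity)
    | succ n hn ih =>
      have h1 := hnext n hn ih 1 le_rfl
      have h2 : (3 / 2 : ℝ) ≤ Real.exp (1 / 2) := by linarith [Real.add_one_le_exp (1 / 2 : ℝ)]
      push_cast
      calc ‖Y ((n : ℝ≥0) + 1) ω‖ ≤ 3 / 2 * K * Real.exp (n / 2) := h1
        _ ≤ Real.exp (1 / 2) * K * Real.exp (n / 2) := by gcongr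
        _ = K * Real.exp (((n : ℝ) + 1) / 2) := by
            rw [show ((n : ℝ) + 1) / 2 = 1 / 2 + n / 2 by ring, Real.exp_add]; ring
  refine ⟨3 / 2 * K, fun t => ?_⟩
  rcases le_total t n₀ with ht | ht
  · have h1 : M ≤ 3 / 2 * K := by linarith [le_max_left M (2 * (1 + b))]
    exact (hM t ht).trans (h1.trans (le_mul_of_one_le_right (by positivity)
      (Real.one_le_exp (by positivity))))
  · have hfl : (⌊t⌋₊ : ℝ≥0) ≤ t := Nat.floor_le zero_le
    have hn : n₀ ≤ ⌊t⌋₊ := Nat.le_floor ht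
    obtain ⟨d, hd⟩ := exists_add_of_le hfl
    have hd1 : d ≤ 1 := by
      have h1 : (⌊t⌋₊ : ℝ≥0) + d ≤ ⌊t⌋₊ + 1 := hd ▸ (Nat.lt_floor_add_one t).le
      exact le_of_add_le_add_left h1
    have h2 := hnext _ hn (hint' _ hn) d hd1
    rw [← hd] at h2
    refine h2.trans ?_
    have : ((⌊t⌋₊ : ℕ) : ℝ) ≤ t := by exact_mod_cast hfl
    gcongr

end Maximal

/-! ### Stieltjes sums for smooth clocks -/

/-- Left Riemann–Stieltjes sums with respect to a smooth increasing function. -/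
lemma tendsto_sum_increment_mul {G : ℝ → ℂ} (hG : Continuous G) {S d : ℝ → ℝ}
    (hS : ∀ x, HasDerivAt S (d x) x) (hd : Continuous d) (hd0 : ∀ x, 0 ≤ x → 0 ≤ d x) {b : ℝ}
    (hb : 0 ≤ b) :
    Tendsto (fun N : ℕ => ∑ i ∈ Finset.range (N + 1),
      ((S ((i + 1 : ℕ) * (b / (N + 1))) - S (i * (b / (N + 1))) : ℝ) : ℂ) * G (i * (b / (N + 1))))
      atTop (𝓝 (∫ x in (0 : ℝ)..b, d x * G x)) := by
  rw [Metric.tendsto_atTop]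
  intro ε hε
  have hSb : 0 ≤ S b - S 0 := by
    rw [← intervalIntegral.integral_eq_sub_of_hasDerivAt (fun x _ => hS x)
      (hd.intervalIntegrable _ _)]
    exact intervalIntegral.integral_nonneg hb fun x hx => hd0 x hx.1
  -- The tolerance for the oscillation of G, to be multiplied by the total increment of S; the 1
  -- covers a zero increment.
  set η := ε / (S b - S 0 + 1) with hη
  have hη0 : 0 < η := by positivity
  have huc := (isCompact_Icc (a := (0 : ℝ)) (b := b)).uniformContinuousOn_of_continuous
    hG.continuousOn
  obtain ⟨δ, hδ, hδG⟩ := Metric.uniformContinuousOn_iff_le.1 huc η hη0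
  have hmesh : Tendsto (fun N : ℕ => b / ((N : ℝ) + 1)) atTop (𝓝 0) := by
    have := (tendsto_const_div_atTop_nhds_zero_nat b).comp (tendsto_add_atTop_nat 1)
    simpa [Function.comp_def] using this
  obtain ⟨N₀, hN₀⟩ := eventually_atTop.1 (hmesh.eventually (ge_mem_nhds hδ))
  refine ⟨N₀, fun N hN => ?_⟩
  have hr : b / ((N : ℝ) + 1) ≤ δ := hN₀ N hN
  set r := b / ((N : ℝ) + 1)
  have hr0 : 0 ≤ r := by positivity
  set s : ℕ → ℝ := fun i => i * r with hs
  have hs0 : s 0 = 0 := by simp [hs]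
  have hsN : s (N + 1) = b := by
    simp only [hs, r]; push_cast; field_simp
  have hsm : Monotone s := fun i j hij => by simp only [hs]; gcongr
  have hsb : ∀ i ≤ N + 1, s i ∈ Set.Icc 0 b := fun i hi =>
    ⟨hs0 ▸ hsm (Nat.zero_le i), hsN ▸ hsm hi⟩
  have hcG : Continuous fun x => (d x : ℂ) * G x := by fun_prop
  have e1 : ∫ x in (0 : ℝ)..b, d x * G x
      = ∑ i ∈ Finset.range (N + 1), ∫ x in s i..s (i + 1), d x * G x := by
    rw [intervalIntegral.sum_integral_adjacent_intervals fun k _ => hcG.intervalIntegrable _ _,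
      hs0, hsN]
  have e2 : ∀ i, ∫ x in s i..s (i + 1), d x = S (s (i + 1)) - S (s i) := fun i =>
    intervalIntegral.integral_eq_sub_of_hasDerivAt (fun x _ => hS x) (hd.intervalIntegrable _ _)
  have hterm : ∀ i ∈ Finset.range (N + 1),
      ‖((S (s (i + 1)) - S (s i) : ℝ) : ℂ) * G (s i) - ∫ x in s i..s (i + 1), d x * G x‖
        ≤ η * (S (s (i + 1)) - S (s i)) := by
    intro i hi
    have hi := Finset.mem_range.1 hi
    have e3 : ((S (s (i + 1)) - S (s i) : ℝ) : ℂ) * G (s i)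
        = ∫ x in s i..s (i + 1), d x * G (s i) := by
      rw [intervalIntegral.integral_mul_const, intervalIntegral.integral_ofReal, e2]
    rw [e3, ← intervalIntegral.integral_sub (Continuous.intervalIntegrable (by fun_prop) _ _)
      (hcG.intervalIntegrable _ _), ← e2, ← intervalIntegral.integral_const_mul]
    refine intervalIntegral.norm_integral_le_of_norm_le (hsm (Nat.le_succ i))
      (Eventually.of_forall fun x hx => ?_) (Continuous.intervalIntegrable (by fun_prop) _ _)
    have hi0 := hsb i hi.le
    have hi1 := hsb (i + 1) hi
    have hx0 : 0 ≤ x := hi0.1.trans hx.1.le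
    rw [← mul_sub, norm_mul, Complex.norm_real, Real.norm_of_nonneg (hd0 x hx0), mul_comm]
    refine mul_le_mul_of_nonneg_right ?_ (hd0 x hx0)
    rw [← dist_eq_norm]
    refine hδG _ hi0 _ ⟨hx0, hx.2.trans hi1.2⟩ ?_
    rw [Real.dist_eq, abs_sub_comm, abs_of_nonneg (by linarith [hx.1])]
    have h3 : s (i + 1) = s i + r := by simp only [hs]; push_cast; ring
    linarith [hx.2]
  rw [dist_eq_norm, e1, ← Finset.sum_sub_distrib]
  calc ‖∑ i ∈ Finset.range (N + 1), (((S (s (i + 1)) - S (s i) : ℝ) : ℂ) * G (s i)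
        - ∫ x in s i..s (i + 1), d x * G x)‖
      ≤ ∑ i ∈ Finset.range (N + 1), η * (S (s (i + 1)) - S (s i)) := norm_sum_le_of_le _ hterm
    _ = η * (S b - S 0) := by
        rw [← Finset.mul_sum, Finset.sum_range_sub (fun i => S (s i)), hs0, hsN]
    _ < ε := by
        rw [hη, div_mul_eq_mul_div, div_lt_iff₀ (by positivity)]
        nlinarith

/-- Strictly increasing clocks that are restrictions of a `C¹` function `S` with derivative `d`. -/
structure IsSmoothClock (σ : ℝ≥0 → ℝ≥0) (S d : ℝ → ℝ) : Prop where
  strictMono : StrictMono σ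
  coe_eq : ∀ s : ℝ≥0, (σ s : ℝ) = S s
  hasDerivAt : ∀ x, HasDerivAt S (d x) x
  continuous_deriv : Continuous d
  deriv_nonneg : ∀ x, 0 ≤ x → 0 ≤ d x

lemma IsSmoothClock.continuous {σ : ℝ≥0 → ℝ≥0} {S d : ℝ → ℝ} (h : IsSmoothClock σ S d) :
    Continuous σ := by
  have hS : Continuous S := continuous_iff_continuousAt.2 fun x => (h.hasDerivAt x).continuousAt
  have h1 : σ = fun s : ℝ≥0 => (S s).toNNReal := funext fun s => by
    rw [← h.coe_eq, Real.toNNReal_coe]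
  rw [h1]
  exact continuous_real_toNNReal.comp (hS.comp NNReal.continuous_coe)

lemma isSmoothClock_id : IsSmoothClock (fun s => s) (fun x => x) (fun _ => 1) where
  strictMono := strictMono_id
  coe_eq := fun _ => rfl
  hasDerivAt := hasDerivAt_id
  continuous_deriv := continuous_const
  deriv_nonneg := fun _ _ => zero_le_one

lemma isSmoothClock_mul {c : ℝ≥0} (hc : 0 < c) :
    IsSmoothClock (fun s => c * s) (fun x => c * x) (fun _ => c) where
  strictMono := fun a b hab => mul_lt_mul_of_pos_left hab hc
  coe_eq := fun s => by simp
  hasDerivAt := fun x => by simpa using (hasDerivAt_id x).const_mul (c : ℝ)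
  continuous_deriv := continuous_const
  deriv_nonneg := fun _ _ => c.2

lemma isSmoothClock_clock {β : ℝ} (hβ : 0 < β) :
    IsSmoothClock (clock β) (fun x => x + 1 / β * Real.exp (-β * x) - 1 / β)
      (fun x => 1 - Real.exp (-β * x)) := by
  have hd : ∀ x : ℝ, HasDerivAt (fun x => x + 1 / β * Real.exp (-β * x) - 1 / β)
      (1 - Real.exp (-β * x)) x := fun x => by
    have h2 := ((hasDerivAt_id x).add
      ((((hasDerivAt_id x).const_mul (-β)).exp).const_mul (1 / β))).sub_const (1 / β)
    refine h2.congr_deriv ?_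
    simp only [id_eq]
    field_simp
    ring
  -- The derivative vanishes at 0 but is positive in the interior of the half-line, which is enough.
  have hmono : StrictMonoOn (fun x : ℝ => x + 1 / β * Real.exp (-β * x) - 1 / β) (Set.Ici 0) := by
    refine strictMonoOn_of_deriv_pos (convex_Ici 0)
      (fun x _ => (hd x).continuousAt.continuousWithinAt) fun x hx => ?_
    rw [interior_Ici, Set.mem_Ioi] at hx
    rw [(hd x).deriv, sub_pos, Real.exp_lt_one_iff]
    nlinarith
  refine ⟨fun a b hab => ?_, coe_clock hβ, hd, by fun_prop, fun x hx => ?_⟩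
  · rw [← NNReal.coe_lt_coe, coe_clock hβ, coe_clock hβ]
    exact hmono a.2 b.2 hab
  · rw [sub_nonneg, Real.exp_le_one_iff]
    nlinarith

lemma clock_le {β : ℝ} (hβ : 0 < β) (s : ℝ≥0) : clock β s ≤ s := by
  rw [← NNReal.coe_le_coe, coe_clock hβ]
  have h1 : Real.exp (-β * s) ≤ 1 := by
    rw [Real.exp_le_one_iff]
    have := s.2
    nlinarith
  have h2 : 1 / β * Real.exp (-β * s) ≤ 1 / β * 1 := by gcongr
  linarith

/-! ### Laws of integrals against time-changed Lévy processes -/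

section Law

variable {E : Type*} [NormedAddCommGroup E] [NormedSpace ℝ E] [SecondCountableTopology E]
  [MeasurableSpace E] [BorelSpace E]
  {Ω : Type*} [MeasurableSpace Ω] {P : Measure Ω} [IsProbabilityMeasure P] {Y : ℝ≥0 → Ω → E}
  {ψ : StrongDual ℝ E → ℂ} {σ : ℝ≥0 → ℝ≥0} {S d : ℝ → ℝ} {f : ℝ≥0 → ℝ}

omit [IsProbabilityMeasure P] [SecondCountableTopology E] in
lemma charFunDual_map_const_smul {X : Ω → E} (hX : AEMeasurable X P) (c : ℝ)
    (L : StrongDual ℝ E) :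
    charFunDual (P.map (fun ω => c • X ω)) L = charFunDual (P.map X) (c • L) := by
  have hc : AEMeasurable (fun ω => c • X ω) P := hX.const_smul c
  rw [charFunDual_map_eq_integral hc, charFunDual_map_eq_integral hX]
  simp

-- Independence turns the sum into a product; each increment contributes its duration, and the
-- scalar c_i moves onto the functional.
omit [IsProbabilityMeasure P] in
lemma IsLevyProcess.charFunDual_sum (hY : IsLevyProcess Y P)
    (hψ : ∀ (t : ℝ≥0) L, charFunDual (P.map (Y t)) L = Complex.exp (t * ψ L)) {τ : ℕ → ℝ≥0}
    (hτ : Monotone τ) (c : ℕ → ℝ) (N : ℕ) (L : StrongDual ℝ E) :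
    charFunDual (P.map fun ω => ∑ i ∈ Finset.range N, c i • (Y (τ (i + 1)) ω - Y (τ i) ω)) L
      = Complex.exp (∑ i ∈ Finset.range N, ((τ (i + 1) - τ i : ℝ) : ℂ) * ψ (c i • L)) := by
  have hm : ∀ i, Measurable fun ω => Y (τ (i + 1)) ω - Y (τ i) ω := fun i =>
    (hY.measurable _).sub (hY.measurable _)
  have hind : iIndepFun (fun i ω => c i • (Y (τ (i + 1)) ω - Y (τ i) ω)) P :=
    (hY.indep_increments.nat hτ).comp (fun i x => c i • x) fun i => measurable_const_smul (c i)
  have hcm : ∀ i, Measurable fun ω => c i • (Y (τ (i + 1)) ω - Y (τ i) ω) := fun i =>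
    (hm i).const_smul (c i)
  rw [iIndepFun.charFunDual_map_fun_finsetSum_eq_prod
    (fun i _ => (hcm i).aemeasurable) (hind.restrict _), Finset.prod_apply,
    Complex.exp_sum]
  refine Finset.prod_congr rfl fun i _ => ?_
  rw [charFunDual_map_const_smul (hm i).aemeasurable]
  obtain ⟨h, hh⟩ := exists_add_of_le (hτ (Nat.le_succ i))
  rw [Nat.succ_eq_add_one] at hh
  rw [hh, hY.map_sub, hψ]
  simp

/-- Characteristic functionals of integrals with respect to time-changed Lévy processes. -/
theorem IsLevyProcess.charFunDual_integral (hY : IsLevyProcess Y P) (hψc : Continuous ψ)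
    (hψ : ∀ (t : ℝ≥0) L, charFunDual (P.map (Y t)) L = Complex.exp (t * ψ L))
    (hσ : IsSmoothClock σ S d) (hf : Continuous f) (b : ℝ≥0) {I : Ω → E}
    (hI : ∀ᵐ ω ∂P, HasRSIntegral f (fun s => Y (σ s) ω) 0 b (I ω)) :
    AEMeasurable I P ∧ ∀ L, charFunDual (P.map I) L
      = Complex.exp (∫ x in (0 : ℝ)..b, d x * ψ (f x.toNNReal • L)) := by
  have hlim : ∀ᵐ ω ∂P, Tendsto
      (fun N => rsSum f (fun s => Y (σ s) ω) (uniformPartition 0 b N)) atTop (𝓝 (I ω)) := by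
    filter_upwards [hI] with ω hω
    exact hω.tendsto_uniformPartition zero_le
  have hm : ∀ N, AEMeasurable
      (fun ω => rsSum f (fun s => Y (σ s) ω) (uniformPartition 0 b N)) P := fun N =>
    (Finset.measurable_sum _ fun i _ =>
      ((hY.measurable _).sub (hY.measurable _)).const_smul _).aemeasurable
  have hIm : AEMeasurable I P := aemeasurable_of_tendsto_metrizable_ae atTop hm hlim
  refine ⟨hIm, fun L => ?_⟩
  refine tendsto_nhds_unique (tendsto_charFunDual_map hm hIm hlim L) ?_
  have hG : Continuous fun x : ℝ => ψ (f x.toNNReal • L) := by fun_prop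
  have key := (tendsto_sum_increment_mul hG hσ.hasDerivAt hσ.continuous_deriv hσ.deriv_nonneg
    b.2).cexp
  refine key.congr fun N => ?_
  set t : ℕ → ℝ≥0 := fun i => 0 + i * ((b - 0) / (N + 1)) with ht
  have htm : Monotone t := fun i j hij => by simp only [ht]; gcongr
  have htc : ∀ i, (t i : ℝ) = i * ((b : ℝ) / (N + 1)) := fun i => by simp [ht]
  have h := hY.charFunDual_sum hψ (hσ.strictMono.monotone.comp htm) (fun i => f (t i)) (N + 1) L
  refine Eq.trans ?_ h.symm
  congr 1
  refine Finset.sum_congr rfl fun i _ => ?_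
  simp only [Function.comp_apply, hσ.coe_eq]
  rw [htc, htc]
  congr 4
  exact (congrArg Real.toNNReal (htc i).symm).trans Real.toNNReal_coe

-- The value is chosen separately for each ω; a.e. measurability comes later, as that of an almost
-- sure limit of sums, in `IsLevyProcess.charFunDual_integral`.
omit [SecondCountableTopology E] [BorelSpace E] [IsProbabilityMeasure P] in
lemma IsLevyProcess.exists_integral [CompleteSpace E] (hY : IsLevyProcess Y P)
    (hσ : IsSmoothClock σ S d) (hf : Continuous f) (hfm : Monotone f ∨ Antitone f) (b : ℝ≥0) :
    ∃ I : Ω → E, ∀ᵐ ω ∂P, HasRSIntegral f (fun s => Y (σ s) ω) 0 b (I ω) := by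
  classical
  have h : ∀ᵐ ω ∂P, ∃ x, HasRSIntegral f (fun s => Y (σ s) ω) 0 b x := by
    filter_upwards [hY.cadlag] with ω hω
    exact (hω.comp_strictMono hσ.strictMono hσ.continuous).exists_hasRSIntegral hfm hf zero_le
  refine ⟨fun ω => if h : ∃ x, HasRSIntegral f (fun s => Y (σ s) ω) 0 b x then h.choose else 0, ?_⟩
  filter_upwards [h] with ω hω
  rw [dif_pos hω]
  exact hω.choose_spec

/-- Existence and characteristic functionals of the improper integrals of `e^{-s}`. -/
theorem IsLevyProcess.exists_improperIntegral [CompleteSpace E] (hY : IsLevyProcess Y P)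
    (hint : Integrable (fun ω => Real.log (1 + ‖Y 1 ω‖)) P) (hψc : Continuous ψ)
    (hψ : ∀ (t : ℝ≥0) L, charFunDual (P.map (Y t)) L = Complex.exp (t * ψ L))
    (hσ : IsSmoothClock σ S d) (hσs : ∀ s, σ s ≤ s) :
    ∃ J : Ω → E, (∀ᵐ ω ∂P, HasImproperRSIntegral (fun s => Real.exp (-(s : ℝ)))
        (fun s => Y (σ s) ω) (J ω)) ∧ AEMeasurable J P ∧
      ∀ L, Tendsto (fun n : ℕ => Complex.exp
          (∫ x in (0 : ℝ)..n, d x * ψ (Real.exp (-x) • L))) atTop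
        (𝓝 (charFunDual (P.map J) L)) := by
  classical
  have h : ∀ᵐ ω ∂P, ∃ x, HasImproperRSIntegral (fun s => Real.exp (-(s : ℝ)))
      (fun s => Y (σ s) ω) x := by
    filter_upwards [hY.cadlag, hY.ae_exists_norm_le hint] with ω hω hK
    obtain ⟨K, hK⟩ := hK
    have hK0 : 0 ≤ K := by simpa using (norm_nonneg _).trans (hK 0)
    -- A clock that never runs ahead of real time preserves the growth bound.
    refine (hω.comp_strictMono hσ.strictMono hσ.continuous).exists_hasImproperRSIntegral
      (K := K) fun s => (hK (σ s)).trans ?_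
    have : (σ s : ℝ) ≤ s := hσs s
    gcongr
  set J : Ω → E := fun ω => if h : ∃ x, HasImproperRSIntegral (fun s => Real.exp (-(s : ℝ)))
      (fun s => Y (σ s) ω) x then h.choose else 0 with hJdef
  have hJ : ∀ᵐ ω ∂P, HasImproperRSIntegral (fun s => Real.exp (-(s : ℝ)))
      (fun s => Y (σ s) ω) (J ω) := by
    filter_upwards [h] with ω hω
    simp only [hJdef]
    rw [dif_pos hω]
    exact hω.choose_spec
  choose I hI using fun n : ℕ =>
    hY.exists_integral hσ continuous_exp_neg (Or.inr antitone_exp_neg) n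
  have hlaw := fun n : ℕ => hY.charFunDual_integral hψc hψ hσ continuous_exp_neg n (hI n)
  have hlim : ∀ᵐ ω ∂P, Tendsto (fun n => I n ω) atTop (𝓝 (J ω)) := by
    filter_upwards [hJ, ae_all_iff.2 hI] with ω h1 h2
    obtain ⟨F, hF, hFJ⟩ := h1
    refine (hFJ.comp (tendsto_natCast_atTop_atTop (R := ℝ≥0))).congr fun n => ?_
    exact (hF n).unique (h2 n) zero_le
  have hJm : AEMeasurable J P :=
    aemeasurable_of_tendsto_metrizable_ae atTop (fun n => (hlaw n).1) hlim
  refine ⟨J, hJ, hJm, fun L => ?_⟩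
  refine (tendsto_charFunDual_map (fun n => (hlaw n).1) hJm hlim L).congr fun n => ?_
  rw [(hlaw n).2 L]
  congr 1
  refine intervalIntegral.integral_congr fun x hx => ?_
  rw [Set.uIcc_of_le (by simp)] at hx
  simp only [Real.coe_toNNReal x hx.1]

end Law

/-! ### The integration by parts behind the identity -/

/-- With k(s) = e^{βs} ∫_0^{e^{-βs}} q one has k' = β(k - q(e^{-βs})), so k(s)(1 - e^{-βs})/β has
derivative k(s) - (1 - e^{-βs}) q(e^{-βs}) and vanishes at s = 0. -/
lemma integral_exp_mul_primitive_sub {q : ℝ → ℂ} (hq : Continuous q) {β : ℝ} (hβ : 0 < β) (b : ℝ) :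
    (∫ s in (0 : ℝ)..b, Real.exp (β * s) * ∫ x in (0 : ℝ)..Real.exp (-β * s), q x)
      - ∫ s in (0 : ℝ)..b, ((1 - Real.exp (-β * s) : ℝ) : ℂ) * q (Real.exp (-β * s))
      = (Real.exp (β * b) * ∫ x in (0 : ℝ)..Real.exp (-β * b), q x)
        * (((1 - Real.exp (-β * b)) / β : ℝ) : ℂ) := by
  set k : ℝ → ℂ := fun s => Real.exp (β * s) * ∫ x in (0 : ℝ)..Real.exp (-β * s), q x with hk
  have hexp : ∀ s, Real.exp (β * s) * Real.exp (-β * s) = 1 := fun s => by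
    rw [← Real.exp_add]; simp
  have d1 : ∀ s, HasDerivAt (fun s => Real.exp (-β * s)) (-β * Real.exp (-β * s)) s := fun s => by
    simpa [mul_comm] using ((hasDerivAt_id s).const_mul (-β)).exp
  have d2 : ∀ s, HasDerivAt (fun s => Real.exp (β * s)) (β * Real.exp (β * s)) s := fun s => by
    simpa [mul_comm] using ((hasDerivAt_id s).const_mul β).exp
  have dk : ∀ s, HasDerivAt k (β * k s - β * q (Real.exp (-β * s))) s := fun s => by
    have h1 : HasDerivAt (fun y => ∫ x in (0 : ℝ)..y, q x) (q (Real.exp (-β * s)))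
      (Real.exp (-β * s)) := (hq.integral_hasStrictDerivAt 0 _).hasDerivAt
    have h2 := h1.scomp s (d1 s)
    refine ((d2 s).ofReal_comp.mul h2).congr_deriv ?_
    simp only [hk, Complex.real_smul, Function.comp_apply]
    have := congrArg (fun x : ℝ => (x : ℂ)) (hexp s)
    push_cast at this ⊢
    linear_combination (-β * q (Real.exp (-β * s))) * this
  have hkc : Continuous k := continuous_iff_continuousAt.2 fun s => (dk s).continuousAt
  have hβ' : (β : ℂ) ≠ 0 := by exact_mod_cast hβ.ne'
  have dD : ∀ s, HasDerivAt (fun s => k s * (((1 - Real.exp (-β * s)) / β : ℝ) : ℂ))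
      (k s - ((1 - Real.exp (-β * s) : ℝ) : ℂ) * q (Real.exp (-β * s))) s := fun s => by
    refine ((dk s).mul ((((d1 s).const_sub 1).div_const β).ofReal_comp)).congr_deriv ?_
    push_cast
    field_simp
    ring
  have hint := intervalIntegral.integral_eq_sub_of_hasDerivAt (a := 0) (b := b) (fun s _ => dD s)
    (Continuous.intervalIntegrable (by fun_prop) _ _)
  rw [intervalIntegral.integral_sub (hkc.intervalIntegrable _ _)
    (Continuous.intervalIntegrable (by fun_prop) _ _)] at hint
  rw [hint, mul_zero, Real.exp_zero, sub_self, zero_div, Complex.ofReal_zero, mul_zero, sub_zero]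

/-! ### Convolution powers -/

section ConvPow

variable {E : Type*} [NormedAddCommGroup E] [NormedSpace ℝ E] [SecondCountableTopology E]
  [MeasurableSpace E] [BorelSpace E]

omit [NormedSpace ℝ E] in
lemma isProbabilityMeasure_convPow (κ : Measure E) [IsProbabilityMeasure κ] (n : ℕ) :
    IsProbabilityMeasure (convPow κ n) := by
  induction n with
  | zero => rw [convPow]; infer_instance
  | succ n ih => rw [convPow]; infer_instance

lemma charFunDual_convPow (κ : Measure E) [IsProbabilityMeasure κ] (n : ℕ) (L : StrongDual ℝ E) :
    charFunDual (convPow κ n) L = charFunDual κ L ^ n := by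
  induction n with
  | zero => simp [convPow]
  | succ n ih =>
    have := isProbabilityMeasure_convPow κ n
    rw [convPow, charFunDual_conv, ih, pow_succ]

end ConvPow

lemma integrable_log_comp {E : Type*} [NormedAddCommGroup E] [MeasurableSpace E]
    {Ω : Type*} [MeasurableSpace Ω] {P : Measure Ω} {X : Ω → E}
    {ν : Measure E} (hX : HasLaw X ν P) (hν : Integrable (fun x : E => Real.log (1 + ‖x‖)) ν) :
    Integrable (fun ω => Real.log (1 + ‖X ω‖)) P := by
  rw [← hX.map_eq] at hν
  exact hν.comp_aemeasurable hX.aemeasurable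

/-! ### The exponent of the power integral -/

section PowerExponent

variable {E : Type*} [NormedAddCommGroup E] [NormedSpace ℝ E] {β : ℝ}

lemma continuous_rpow_inv (hβ : 0 < β) : Continuous fun t : ℝ≥0 => (t : ℝ) ^ (1 / β) :=
  NNReal.continuous_coe.rpow_const fun _ => Or.inr (by positivity)

lemma monotone_rpow_inv (hβ : 0 < β) : Monotone fun t : ℝ≥0 => (t : ℝ) ^ (1 / β) :=
  fun s t h => Real.rpow_le_rpow s.2 (NNReal.coe_le_coe.2 h) (by positivity)

/-- The exponent of the law of `∫_0^1 t^{1/β} dY(t)`. -/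
noncomputable def powerExponent (β : ℝ) (ψ : StrongDual ℝ E → ℂ) (L : StrongDual ℝ E) : ℂ :=
  ∫ x in (0 : ℝ)..1, ψ (((x.toNNReal : ℝ) ^ (1 / β)) • L)

lemma continuous_comp_rpow_smul (hβ : 0 < β) {ψ : StrongDual ℝ E → ℂ} (hψ : Continuous ψ)
    (L : StrongDual ℝ E) : Continuous fun x : ℝ => ψ (((x.toNNReal : ℝ) ^ (1 / β)) • L) :=
  hψ.comp (((continuous_rpow_inv hβ).comp continuous_real_toNNReal).smul continuous_const)

lemma continuous_powerExponent (hβ : 0 < β) {ψ : StrongDual ℝ E → ℂ} (hψ : Continuous ψ) :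
    Continuous (powerExponent β ψ) := by
  refine intervalIntegral.continuous_parametric_intervalIntegral_of_continuous' ?_ 0 1
  exact hψ.comp ((((continuous_rpow_inv hβ).comp continuous_real_toNNReal).comp
    continuous_snd).smul continuous_fst)

lemma powerExponent_zero {ψ : StrongDual ℝ E → ℂ} (hψ : ψ 0 = 0) : powerExponent β ψ 0 = 0 := by
  simp [powerExponent, hψ]

/-- Substitute x ↦ e^{-βs}x: its power 1/β produces exactly the factor e^{-s} on the functional. -/
lemma powerExponent_exp_smul (hβ : 0 < β) (ψ : StrongDual ℝ E → ℂ) (L : StrongDual ℝ E) (s : ℝ) :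
    powerExponent β ψ (Real.exp (-s) • L) = Real.exp (β * s) *
      ∫ x in (0 : ℝ)..Real.exp (-β * s), ψ (((x.toNNReal : ℝ) ^ (1 / β)) • L) := by
  have h := intervalIntegral.integral_comp_mul_right (a := 0) (b := 1)
    (fun x : ℝ => ψ (((x.toNNReal : ℝ) ^ (1 / β)) • L)) (Real.exp_ne_zero (-β * s))
  rw [zero_mul, one_mul, ← Real.exp_neg, neg_mul, neg_neg, Complex.real_smul] at h
  rw [neg_mul, ← h, powerExponent]
  refine intervalIntegral.integral_congr fun x hx => ?_
  rw [Set.uIcc_of_le zero_le_one] at hx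
  rw [Real.coe_toNNReal x hx.1, Real.coe_toNNReal _ (mul_nonneg hx.1 (Real.exp_pos _).le),
    Real.mul_rpow hx.1 (Real.exp_pos _).le, ← Real.exp_mul, smul_smul,
    show -(β * s) * (1 / β) = -s by field_simp]

/-- The exponents of the two improper integrals agree in the limit. -/
lemma tendsto_integral_powerExponent_sub (hβ : 0 < β) {ψ : StrongDual ℝ E → ℂ} (hψ : Continuous ψ)
    (hψ0 : ψ 0 = 0) (L : StrongDual ℝ E) :
    Tendsto (fun n : ℕ => (∫ x in (0 : ℝ)..n, powerExponent β ψ (Real.exp (-x) • L))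
      - ∫ x in (0 : ℝ)..n, ((1 - Real.exp (-β * x) : ℝ) : ℂ) * ψ (Real.exp (-x) • L))
      atTop (𝓝 0) := by
  have hq := continuous_comp_rpow_smul hβ hψ L
  have hqe : ∀ s : ℝ, ψ ((((Real.exp (-β * s)).toNNReal : ℝ) ^ (1 / β)) • L)
      = ψ (Real.exp (-s) • L) := fun s => by
    rw [Real.coe_toNNReal _ (Real.exp_pos _).le, ← Real.exp_mul,
      show -β * s * (1 / β) = -s by field_simp]
  have key : ∀ n : ℕ, (∫ x in (0 : ℝ)..n, powerExponent β ψ (Real.exp (-x) • L))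
      - ∫ x in (0 : ℝ)..n, ((1 - Real.exp (-β * x) : ℝ) : ℂ) * ψ (Real.exp (-x) • L)
      = powerExponent β ψ (Real.exp (-(n : ℝ)) • L)
        * (((1 - Real.exp (-β * n)) / β : ℝ) : ℂ) := fun n => by
    have h := integral_exp_mul_primitive_sub hq hβ n
    simp only [← powerExponent_exp_smul hβ, hqe] at h
    exact h
  simp_rw [key]
  have he : Tendsto (fun n : ℕ => Real.exp (-(n : ℝ))) atTop (𝓝 0) :=
    Real.tendsto_exp_neg_atTop_nhds_zero.comp tendsto_natCast_atTop_atTop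
  have h1 : Tendsto (fun n : ℕ => powerExponent β ψ (Real.exp (-(n : ℝ)) • L)) atTop (𝓝 0) := by
    have hc : Continuous fun r : ℝ => powerExponent β ψ (r • L) :=
      (continuous_powerExponent hβ hψ).comp (continuous_id.smul continuous_const)
    have := (hc.tendsto 0).comp he
    rwa [zero_smul, powerExponent_zero hψ0] at this
  refine squeeze_zero_norm (a := fun n : ℕ =>
    ‖powerExponent β ψ (Real.exp (-(n : ℝ)) • L)‖ * (1 / β)) (fun n => ?_) ?_
  · rw [norm_mul, Complex.norm_real, Real.norm_eq_abs]
    have h2 : Real.exp (-β * n) ≤ 1 := by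
      rw [Real.exp_le_one_iff]
      have : (0 : ℝ) ≤ n := n.cast_nonneg
      nlinarith
    rw [abs_of_nonneg (div_nonneg (by linarith) hβ.le)]
    gcongr
    linarith [Real.exp_pos (-β * n)]
  · simpa using h1.norm.mul_const (1 / β)

end PowerExponent

/-! ### Infinite divisibility and logarithmic moment of the power integral -/

section Main

variable {E : Type*} [NormedAddCommGroup E] [NormedSpace ℝ E] [CompleteSpace E]
  [SecondCountableTopology E] [MeasurableSpace E] [BorelSpace E]

lemma hasLaw_of_charFunDual_eq {Ω : Type*} [MeasurableSpace Ω] {P : Measure Ω}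
    [IsProbabilityMeasure P] {X : Ω → E} (hX : AEMeasurable X P) {μ : Measure E}
    [IsProbabilityMeasure μ] (h : ∀ L, charFunDual (P.map X) L = charFunDual μ L) :
    HasLaw X μ P := by
  have := Measure.isProbabilityMeasure_map hX
  exact ⟨hX, Measure.ext_of_charFunDual (funext h)⟩

/-- The random integral `∫_0^1 t^{1/β} dY(t)` is infinitely divisible and inherits logarithmic
moments. -/
theorem IsLevyProcess.isIDLog_power_integral {β : ℝ} (hβ : 0 < β) {Ω : Type*} [MeasurableSpace Ω]
    {P : Measure Ω} [IsProbabilityMeasure P] {Y : ℝ≥0 → Ω → E} (hY : IsLevyProcess Y P)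
    (hint : Integrable (fun ω => Real.log (1 + ‖Y 1 ω‖)) P) {I : Ω → E}
    (hI : ∀ᵐ ω ∂P, HasRSIntegral (fun t => (t : ℝ) ^ (1 / β)) (fun s => Y s ω) 0 1 (I ω)) :
    IsIDLog (P.map I) := by
  obtain ⟨ψ, hψc, hψ0, hψ⟩ := hY.exists_exponent
  obtain ⟨hIm, hIL⟩ := hY.charFunDual_integral hψc hψ isSmoothClock_id (continuous_rpow_inv hβ) 1 hI
  have hprob := Measure.isProbabilityMeasure_map hIm
  refine ⟨⟨hprob, fun n hn => ?_⟩, ?_⟩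
  · have hn0 : (n : ℂ) ≠ 0 := by exact_mod_cast hn.ne'
    -- The n-th convolution root is the law of the same integral against Y(t/n), whose exponent is
    -- 1/n times the original.
    have hclock := isSmoothClock_mul (c := (n : ℝ≥0)⁻¹) (by positivity)
    obtain ⟨K, hK⟩ := hY.exists_integral hclock (continuous_rpow_inv hβ)
      (Or.inl (monotone_rpow_inv hβ)) 1
    obtain ⟨hKm, hKL⟩ := hY.charFunDual_integral hψc hψ hclock (continuous_rpow_inv hβ) 1 hK
    have hKprob := Measure.isProbabilityMeasure_map hKm
    refine ⟨P.map K, hKprob, ?_⟩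
    have := isProbabilityMeasure_convPow (P.map K) n
    refine Measure.ext_of_charFunDual (funext fun L => ?_)
    rw [charFunDual_convPow, hKL, hIL, ← Complex.exp_nat_mul,
      intervalIntegral.integral_const_mul, intervalIntegral.integral_const_mul]
    congr 1
    push_cast
    rw [← mul_assoc, mul_inv_cancel₀ hn0]
  · obtain ⟨b, hb0, hb⟩ := hY.exists_measure_norm_gt_le_half
    have hlog : Integrable (fun ω => Real.log (1 + ‖I ω‖)) P := by
      -- C = 2 is the summation-by-parts constant 2(|f(0)| + |f(1)|) for f(t) = t^{1/β}.
      refine integrable_log_of_tail_le (X := Y 1) (C := 2) hIm one_le_two hb0 (fun a _ => ?_) hint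
      refine le_trans (measure_mono_ae ?_) (hY.measure_exists_norm_gt_le hb 0 a)
      filter_upwards [hI, hY.start_zero] with ω hω h0 (hlt : 2 * (a + b) < ‖I ω‖)
      show ∃ t ≤ 1, a + b < ‖Y (0 + t) ω - Y 0 ω‖
      by_contra! hcon
      have h := hω.norm_le (Or.inl (monotone_rpow_inv hβ)) zero_le_one (M := a + b)
        fun t _ ht => by simpa [h0] using hcon t ht
      have hz : (0 : ℝ) ^ (1 / β) = 0 := Real.zero_rpow (by positivity)
      simp only [NNReal.coe_zero, NNReal.coe_one, hz, Real.one_rpow, abs_zero, abs_one, zero_add,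
        mul_one] at h
      linarith
    rw [integrable_map_measure _ hIm]
    · exact hlog
    · exact Measurable.aestronglyMeasurable (by fun_prop)

end Main

end RandomIntegral

/-! ### Comparison of the laws through their exponents -/

theorem proposition2 {E : Type u} [NormedAddCommGroup E] [NormedSpace ℝ E]
    [CompleteSpace E] [SecondCountableTopology E] [MeasurableSpace E] [BorelSpace E]
    (β : ℝ) (hβ : 0 < β) (ν : Measure E) (hν : IsIDLog ν)
    -- `Y = Y_ν`
    {Ω : Type v} [MeasurableSpace Ω] (P : Measure Ω) [IsProbabilityMeasure P]
    (Y : ℝ≥0 → Ω → E) (hY : IsLevyProcess Y P) (hYν : HasLaw (Y 1) ν P) :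
    ∃ μ ρ : Measure E,
      -- `μ = 𝒥^β(ν)`, whichever Lévy process with law `ν` at time `1` is used
      (∀ (Ω₁ : Type v) [MeasurableSpace Ω₁] (P₁ : Measure Ω₁) [IsProbabilityMeasure P₁]
          (Y₁ : ℝ≥0 → Ω₁ → E), IsLevyProcess Y₁ P₁ → HasLaw (Y₁ 1) ν P₁ →
        IntegralHasLaw (fun t => (t : ℝ) ^ (1 / β)) Y₁ 0 1 P₁ μ) ∧
      -- `𝒥^β(ν)` lies in the domain `ID_log` of `ℐ`
      IsIDLog μ ∧
      -- `ρ = ℐ(μ)`, whichever Lévy process with law `μ` at time `1` is used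
      (∀ (Ω₂ : Type w) [MeasurableSpace Ω₂] (P₂ : Measure Ω₂) [IsProbabilityMeasure P₂]
          (Z : ℝ≥0 → Ω₂ → E), IsLevyProcess Z P₂ → HasLaw (Z 1) μ P₂ →
        ImproperIntegralHasLaw (fun s => Real.exp (-(s : ℝ))) Z P₂ ρ) ∧
      -- `∫_0^∞ e^{-s} dY_ν(σ_β(s))` converges almost surely and has law `ρ`
      ImproperIntegralHasLaw (fun s => Real.exp (-(s : ℝ))) (fun s => Y (clock β s)) P ρ := by
  obtain ⟨ψ, hψc, hψ0, hψ⟩ := hY.exists_exponent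
  have hνψ : ∀ L, charFunDual ν L = Complex.exp (ψ L) := fun L => by
    rw [← hYν.map_eq, hψ]; simp
  have hint : Integrable (fun ω => Real.log (1 + ‖Y 1 ω‖)) P := integrable_log_comp hYν hν.2
  obtain ⟨I, hI⟩ := hY.exists_integral isSmoothClock_id (continuous_rpow_inv hβ)
    (Or.inl (monotone_rpow_inv hβ)) 1
  obtain ⟨hIm, hIL⟩ := hY.charFunDual_integral hψc hψ isSmoothClock_id (continuous_rpow_inv hβ) 1 hI
  obtain ⟨J, hJ, hJm, hJL⟩ := hY.exists_improperIntegral hint hψc hψ (isSmoothClock_clock hβ)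
    (clock_le hβ)
  have hIprob := Measure.isProbabilityMeasure_map hIm
  have hJprob := Measure.isProbabilityMeasure_map hJm
  have hμ : IsIDLog (P.map I) := hY.isIDLog_power_integral hβ hint hI
  have hμψ : ∀ L, charFunDual (P.map I) L = Complex.exp (powerExponent β ψ L) := fun L => by
    rw [hIL, powerExponent]
    simp
  refine ⟨P.map I, P.map J, ?_, hμ, ?_, J, hJ, hJm, rfl⟩
  · intro Ω₁ _ P₁ _ Y₁ hY₁ hY₁ν
    obtain ⟨ψ₁, hψ₁c, hψ₁0, hψ₁⟩ := hY₁.exists_exponent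
    obtain rfl : ψ₁ = ψ := exponent_unique hψ₁c hψc hψ₁0 hψ0
      (fun L => by rw [← hY₁ν.map_eq, hψ₁]; simp) hνψ
    obtain ⟨I₁, hI₁⟩ := hY₁.exists_integral isSmoothClock_id (continuous_rpow_inv hβ)
      (Or.inl (monotone_rpow_inv hβ)) 1
    obtain ⟨hI₁m, hI₁L⟩ := hY₁.charFunDual_integral hψ₁c hψ₁ isSmoothClock_id
      (continuous_rpow_inv hβ) 1 hI₁
    exact ⟨I₁, hI₁, hasLaw_of_charFunDual_eq hI₁m fun L => by rw [hI₁L, hIL]⟩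
  · intro Ω₂ _ P₂ _ Z hZ hZμ
    obtain ⟨χ, hχc, hχ0, hχ⟩ := hZ.exists_exponent
    obtain rfl : χ = powerExponent β ψ := exponent_unique hχc (continuous_powerExponent hβ hψc) hχ0
      (powerExponent_zero hψ0) (fun L => by rw [← hZμ.map_eq, hχ]; simp) hμψ
    obtain ⟨K, hK, hKm, hKL⟩ := hZ.exists_improperIntegral (integrable_log_comp hZμ hμ.2) hχc hχ
      isSmoothClock_id fun _ => le_rfl
    refine ⟨K, hK, hasLaw_of_charFunDual_eq hKm fun L => ?_⟩
    -- Only the difference of the truncated exponents needs a limit, namely 0; the exponents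
    -- themselves need not be shown to converge.
    refine tendsto_nhds_unique (hKL L) ?_
    have h := (hJL L).mul (tendsto_integral_powerExponent_sub hβ hψc hψ0 L).cexp
    rw [Complex.exp_zero, mul_one] at h
    refine h.congr fun n => ?_
    rw [← Complex.exp_add]
    simp
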